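/- Let $s_0\in(0,\pi/2)$ be defined by $\sin s_0=\sqrt{2/3}$. Let $f:[0,s_0]\to\mathbb R$ be $C^1$ and monotonically increasing (not necessarily strictly) with $0<f(0)<1$ and $f(s_0)=1$, and let $g:[0,s_0]\to\mathbb C$ satisfy $|g(s)|^2+f(s)^2\cos^2 s=1$ for all $s$. Let $(e_-,e_0,e_+)$ be the standard orthonormal basis of $\mathbb C^3$, and let $h(s)$ be the orthogonal projection in $\mathbb C^3\otimes\mathbb C^3$ onto the span of $$e_+\otimes e_+,\quad e_-\otimes e_-,\quad e_+\otimes e_0+f(s)\,e_0\otimes e_+,\quad e_0\otimes e_-+f(s)\,e_-\otimes e_0,$$ $$e_+\otimes e_-+g(s)\frac{\sin s}{\cos^2 s}\,e_0\otimes e_0+f(s)^2\,e_-\otimes e_+ .$$ (For $f(0)=1/\sqrt2$ this is the path from the PVBS interaction with $\lambda_-=1/\sqrt2$, $\lambda_+=\sqrt2$ at $s=0$ to the AKLT interaction at $s=s_0$.) Let $H_{[a,b]}(s)=\sum_{x=a}^{b-1}h(s)_{x,x+1}$, where $h(s)_{x,x+1}$ acts on sites $x,x+1$ of a chain, and let $G_{[a,b]}(s)$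 be the orthogonal projection onto $\ker H_{[a,b]}(s)$ (tensored with the identity on the remaining sites; it is the identity if $a=b$). For integers $1\le k\le N$ define, on the chain $[1,N+1]$, $$g_{k,N}(s)=\left\|G_{[N-k+2,N+1]}(s)\left(G_{[1,N]}(s)-G_{[1,N+1]}(s)\right)\right\| .$$ Put $t_2(s)=t_3(s)=-f(s)\cos^2 s$, $t_4(s)=f(s)^2\cos^2 s-\sin^2 s$ and $\varepsilon=\sup_{s\in[0,s_0]}\max_{i\in\{2,3,4\}}|t_i(s)|$. Then: (i) $\varepsilon<1$, and there is a function $C:[0,s_0]\to\mathbb R$, continuous on $(0,s_0]$, such that for all $s\in[0,s_0]$, all $k\ge1$ and all $N\ge\max\{k,2k-2\}$, $$g_{k,N}(s)^2\le C(s)\,\varepsilon^{k-1}.$$ (ii) Let $0<c<1$, let $s_1,s_2\in[0,\pi/2]$ be defined by $$\sin^2 s_1=\frac{1-c^2}{1+c^2},\qquad \sin^2 s_2=\frac{c^2(1-2\ln c)}{1+c^2},$$ and let $\delta=\min\{s_1,s_2,s_0/2\}$. Assume that $f(s)=c$ for all $0\le s<\delta$. Then there is $k_1$ such that $g_{k,N}(s)^2<1/k$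 for all $k\ge \max\{k_1,1\}$, all $N\ge\max\{k,2k-2\}$ and all $0\le s<\delta$. -/

import Mathlib

open Set

namespace AKLTPath

noncomputable section

/-- Labels of the basis `e_-, e_0, e_+` of the one-site space `ℂ³`; they are the elements
`-1, 0, 1` of `SignType`. -/
abbrev Spin := SignType

/-- The two-site space `ℂ³ ⊗ ℂ³`, with orthonormal basis `e_i ⊗ e_j` indexed by `(i, j)`. -/
abbrev TwoSite := EuclideanSpace ℂ (Spin × Spin)

/-- The Hilbert space `(ℂ³)^{⊗ L}` of a chain of `L` sites, with orthonormal basis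
`e_{σ 0} ⊗ ⋯ ⊗ e_{σ (L-1)}` indexed by the configurations `σ`. -/
abbrev Chain (L : ℕ) := EuclideanSpace ℂ (Fin L → Spin)

/-- The basis vector `e_i ⊗ e_j`. -/
def e (i j : Spin) : TwoSite := EuclideanSpace.single (i, j) 1

/-- The endpoint of the path: `sin s₀ = √(2/3)`, `0 < s₀ < π/2`. -/
def s₀ : ℝ := Real.arcsin (√(2 / 3))

/-- The five vectors that span the range of the interaction at the parameter `s`. -/
def penalized (f : ℝ → ℝ) (g : ℝ → ℂ) (s : ℝ) : Set TwoSite :=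
  {e 1 1,
   e (-1) (-1),
   e 1 0 + (f s : ℂ) • e 0 1,
   e 0 (-1) + (f s : ℂ) • e (-1) 0,
   e 1 (-1) + (g s * (Real.sin s / Real.cos s ^ 2 : ℝ)) • e 0 0 + (f s ^ 2 : ℂ) • e (-1) 1}

/-- The nearest neighbour interaction `h(s)`: the orthogonal projection onto the span of
the five vectors `penalized f g s`. -/
def interaction (f : ℝ → ℝ) (g : ℝ → ℂ) (s : ℝ) : TwoSite →L[ℂ] TwoSite :=
  (Submodule.span ℂ (penalized f g s)).starProjection

/-- The operator on the chain that acts as `A` on the (distinct) sites `x, y` and as the identity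
on all other sites: at the configuration `σ`, apply `A` to the vector
`(i, j) ↦ ψ (σ with σ x, σ y replaced by i, j)`, and take the component at `(σ x, σ y)`. -/
def onSites {L : ℕ} (A : TwoSite →L[ℂ] TwoSite) (x y : Fin L) : Chain L →ₗ[ℂ] Chain L where
  toFun ψ := WithLp.toLp 2 fun σ =>
    A (WithLp.toLp 2 fun p : Spin × Spin =>
      ψ (Function.update (Function.update σ x p.1) y p.2)) (σ x, σ y)
  map_add' ψ φ := by
    ext σ
    exact congrArg (fun v : TwoSite => v (σ x, σ y)) (map_add A
      (WithLp.toLp 2 fun p : Spin × Spin =>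
        ψ (Function.update (Function.update σ x p.1) y p.2))
      (WithLp.toLp 2 fun p : Spin × Spin =>
        φ (Function.update (Function.update σ x p.1) y p.2)))
  map_smul' c ψ := by
    ext σ
    exact congrArg (fun v : TwoSite => v (σ x, σ y)) (map_smul A c
      (WithLp.toLp 2 fun p : Spin × Spin =>
        ψ (Function.update (Function.update σ x p.1) y p.2)))

/-- The Hamiltonian `H_{[a,b]}(s) = ∑_{x=a}^{b-1} h(s)_{x,x+1}`, regarded as an operator on the
chain `[1, N+1]`. The sites are numbered from `1`, so the bond with index `x : Fin N` joins
the sites `x + 1` and `x + 2`. -/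
def hamiltonian (f : ℝ → ℝ) (g : ℝ → ℂ) (s : ℝ) (N a b : ℕ) : Chain (N + 1) →ₗ[ℂ] Chain (N + 1) :=
  ∑ x : Fin N with a ≤ x.val + 1 ∧ x.val + 1 < b,
    onSites (interaction f g s) x.castSucc x.succ

/-- The projection `G_{[a,b]}(s)` on the chain `[1, N+1]`: the orthogonal projection onto the
ground states of `H_{[a,b]}(s)`, tensored with the identity on the sites outside `[a,b]`. -/
def groundProj (f : ℝ → ℝ) (g : ℝ → ℂ) (s : ℝ) (N a b : ℕ) : Chain (N + 1) →L[ℂ] Chain (N + 1) :=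
  (LinearMap.ker (hamiltonian f g s N a b)).starProjection

/-- `g_{k,N}(s) = ‖G_{[N-k+2,N+1]}(s) (G_{[1,N]}(s) - G_{[1,N+1]}(s))‖`, for `1 ≤ k ≤ N`. -/
def martingaleNorm (f : ℝ → ℝ) (g : ℝ → ℂ) (k N : ℕ) (s : ℝ) : ℝ :=
  ‖groundProj f g s N (N - k + 2) (N + 1) ∘L
    (groundProj f g s N 1 N - groundProj f g s N 1 (N + 1))‖

/-- The eigenvalues `t₂(s) = t₃(s)` of the transfer operator. -/
def t₂ (f : ℝ → ℝ) (s : ℝ) : ℝ := -(f s) * Real.cos s ^ 2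

/-- The eigenvalue `t₄(s)` of the transfer operator. -/
def t₄ (f : ℝ → ℝ) (s : ℝ) : ℝ := f s ^ 2 * Real.cos s ^ 2 - Real.sin s ^ 2

/-- `ε = sup_{s ∈ [0,s₀]} max_{i=2,3,4} |t_i(s)|`. -/
def decayRate (f : ℝ → ℝ) : ℝ :=
  sSup ((fun s => max |t₂ f s| |t₄ f s|) '' Icc 0 s₀)

end

end AKLTPath

/-! The interaction is frustration free: ground states of an interval are exactly the vectors whose
amplitudes satisfy five linear relations at each bond (`mem_ker_hamiltonian_iff_bondRel`). Solving
these from the last site shows that four amplitudes determine a ground state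
(`groundSpace_eq_zero`). Bond-dimension-two matrix products with p = cos s, b = sin s, a = -conj g
satisfy the relations. Their four entries become dependent at s = 0, so `mps` uses rescaled
combinations, polynomial in b, which still span the ground space there (`exists_mps_coeff`). This
makes every later bound uniform down to s = 0.

The Gram matrix of this basis is explicit in powers of the transfer eigenvalues u = t₂ and t = t₄
(`mps_isGram`). It converges at rate √ε^n to a diagonal matrix, uniformly along the path
(`exists_nearLimit`); the square root absorbs a factor n, and disappears when the norm is squared.

Let ψ be a ground state on the first N = l + m sites that is orthogonal to all ground states on N +
1 sites. Expand ψ in the basis of N sites with coefficients depending on the last spin.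
Orthogonality is four linear conditions, which the Gram limit turns into four decoupled limiting
expressions of size O(√ε^m). Cutting the chain (`mps_append`) rewrites ψ as a sum of left basis
vectors times right vectors. The limiting expressions of each right vector are, up to O(√ε^m),
multiples of those of ψ (`norm_overlapLimit_restrictCoeff_le`), hence small as well. So ψ is almost
orthogonal to every ground state of the last m + 1 sites (`exists_norm_ampInner_le`), and with k = m
+ 1 this bounds the norm of the product of projections.

Compactness gives ε < 1 and a positive lower bound for 1 - f² cos² (`decayRate_bounds`). So C in (i)
can be a constant, and (ii) follows because kε^(k-1) tends to 0. -/

namespace AKLTPath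

/-! ### Bond relations and the kernel of the Hamiltonian. -/

/-- The amplitudes `ψ (i, j)` of a two-site vector orthogonal to the penalized vectors. -/
def BondRel (f : ℝ) (κ : ℂ) (v : Spin → Spin → ℂ) : Prop :=
  v 1 1 = 0 ∧ v (-1) (-1) = 0 ∧ v 1 0 + f * v 0 1 = 0 ∧ v 0 (-1) + f * v (-1) 0 = 0 ∧
    v 1 (-1) + κ * v 0 0 + (f : ℂ) ^ 2 * v (-1) 1 = 0

/-- The two-site vector seen at the sites `x, y` when the other sites are frozen to `σ`. -/
noncomputable def bondSlice {L : ℕ} (ψ : Chain L) (x y : Fin L) (σ : Fin L → Spin) : TwoSite :=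
  WithLp.toLp 2 fun p : Spin × Spin => ψ (Function.update (Function.update σ x p.1) y p.2)

lemma onSites_apply {L : ℕ} (A : TwoSite →L[ℂ] TwoSite) (x y : Fin L) (ψ : Chain L)
    (σ : Fin L → Spin) : onSites A x y ψ σ = A (bondSlice ψ x y σ) (σ x, σ y) := rfl

lemma bondSlice_update {L : ℕ} (ψ : Chain L) {x y : Fin L} (hxy : x ≠ y) (σ : Fin L → Spin)
    (i j : Spin) :
    bondSlice ψ x y (Function.update (Function.update σ x i) y j) = bondSlice ψ x y σ := by
  ext p
  change ψ _ = ψ _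
  refine congrArg (fun τ => ψ τ) ?_
  rw [Function.update_comm hxy, Function.update_idem, Function.update_comm hxy.symm,
    Function.update_idem]

/-- Swapping the spin at `x` with the extra spin `i` is an involution of the pairs (σ, i); after it
the sum no longer depends on `i`, which leaves the factor 3. -/
lemma sum_sum_update {L : ℕ} (F : (Fin L → Spin) → ℂ) (x : Fin L) :
    ∑ σ, ∑ i, F (Function.update σ x i) = 3 * ∑ σ, F σ := by
  let E : ((Fin L → Spin) × Spin) ≃ ((Fin L → Spin) × Spin) :=
    { toFun := fun q => (Function.update q.1 x q.2, q.1 x)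
      invFun := fun q => (Function.update q.1 x q.2, q.1 x)
      left_inv := fun q => by simp
      right_inv := fun q => by simp }
  have h := Equiv.sum_comp E (fun q => F q.1)
  rw [Fintype.sum_prod_type, Fintype.sum_prod_type] at h
  change ∑ σ, ∑ i, F (Function.update σ x i) = _ at h
  rw [h, Finset.mul_sum]
  refine Finset.sum_congr rfl fun σ _ => ?_
  have : Fintype.card SignType = 3 := rfl
  simp [this]

/-- A slice does not depend on the two spins of σ that it replaces, so summing over all σ counts
every configuration 3 · 3 times. This carries positivity of a two-site operator over to the chain.
-/
lemma inner_onSites {L : ℕ} (A : TwoSite →L[ℂ] TwoSite) {x y : Fin L} (hxy : x ≠ y)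
    (ψ : Chain L) :
    ∑ σ, inner ℂ (bondSlice ψ x y σ) (A (bondSlice ψ x y σ)) =
      9 * inner ℂ ψ (onSites A x y ψ) := by
  have h1 := sum_sum_update (fun τ => ∑ j, inner ℂ (ψ (Function.update τ y j))
    (onSites A x y ψ (Function.update τ y j))) x
  rw [sum_sum_update (fun τ => inner ℂ (ψ τ) (onSites A x y ψ τ)) y, ← mul_assoc] at h1
  rw [PiLp.inner_apply]
  have h9 : (9 : ℂ) = 3 * 3 := by norm_num
  rw [h9, ← h1]
  refine Finset.sum_congr rfl fun σ _ => ?_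
  rw [PiLp.inner_apply, Fintype.sum_prod_type]
  refine Finset.sum_congr rfl fun i _ => Finset.sum_congr rfl fun j _ => ?_
  rw [onSites_apply, bondSlice_update ψ hxy]
  simp [bondSlice, hxy]

/-- The expectation of the Hamiltonian is, up to the factor 9, a sum of squared norms of projected
slices; it vanishes only if each of them does. -/
lemma mem_ker_hamiltonian (f : ℝ → ℝ) (g : ℝ → ℂ) (s : ℝ) (N a b : ℕ) (ψ : Chain (N + 1)) :
    ψ ∈ LinearMap.ker (hamiltonian f g s N a b) ↔
      ∀ x : Fin N, a ≤ x.val + 1 → x.val + 1 < b →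
        ∀ σ, interaction f g s (bondSlice ψ x.castSucc x.succ σ) = 0 := by
  have key : ∀ v : TwoSite, inner ℂ v (interaction f g s v) =
      ((‖interaction f g s v‖ ^ 2 : ℝ) : ℂ) := by
    intro v
    have h := inner_self_eq_norm_sq_to_K (𝕜 := ℂ) (interaction f g s v)
    rw [interaction, Submodule.inner_starProjection_left_eq_right] at h
    rw [interaction]
    have h2 : (Submodule.span ℂ (penalized f g s)).starProjection
        ((Submodule.span ℂ (penalized f g s)).starProjection v) =
        (Submodule.span ℂ (penalized f g s)).starProjection v :=
      Submodule.starProjection_eq_self_iff.2 (Submodule.starProjection_apply_mem _ _)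
    rw [h2] at h
    rw [h]; push_cast; rfl
  rw [LinearMap.mem_ker]
  constructor
  · intro h
    have h0 : (9 : ℂ) * inner ℂ ψ (hamiltonian f g s N a b ψ) = 0 := by rw [h]; simp
    rw [hamiltonian, LinearMap.sum_apply, inner_sum, Finset.mul_sum] at h0
    rw [Finset.sum_congr rfl (fun x _ => (inner_onSites (interaction f g s)
      (Fin.castSucc_lt_succ (i := x)).ne ψ).symm)] at h0
    simp only [key] at h0
    have h1 : ∑ x : Fin N with a ≤ x.val + 1 ∧ x.val + 1 < b,
        ∑ σ, ‖interaction f g s (bondSlice ψ x.castSucc x.succ σ)‖ ^ 2 = 0 := by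
      exact_mod_cast h0
    intro x hxa hxb σ
    rw [Finset.sum_eq_zero_iff_of_nonneg
      (fun x _ => Finset.sum_nonneg fun σ _ => sq_nonneg _)] at h1
    have h2 := h1 x (by simp [hxa, hxb])
    rw [Finset.sum_eq_zero_iff_of_nonneg (fun σ _ => sq_nonneg _)] at h2
    simpa using h2 σ (Finset.mem_univ _)
  · intro h
    rw [hamiltonian, LinearMap.sum_apply]
    refine Finset.sum_eq_zero fun x hx => ?_
    simp only [Finset.mem_filter, Finset.mem_univ, true_and] at hx
    ext σ
    rw [onSites_apply, h x hx.1 hx.2 σ]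
    rfl

/-- The kernel of the projection is the orthogonal complement of the spanning vectors. The inner
product is conjugate linear in its first slot, hence the conjugate of `g`. -/
lemma interaction_eq_zero_iff (f : ℝ → ℝ) (g : ℝ → ℂ) (s : ℝ) (v : TwoSite) :
    interaction f g s v = 0 ↔
      BondRel (f s) (starRingEnd ℂ (g s) * (Real.sin s / Real.cos s ^ 2 : ℝ))
        (fun i j => v (i, j)) := by
  rw [interaction, Submodule.starProjection_apply_eq_zero_iff, Submodule.mem_orthogonal]
  have h1 : (∀ u ∈ Submodule.span ℂ (penalized f g s), inner ℂ u v = 0) ↔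
      ∀ u ∈ penalized f g s, inner ℂ u v = 0 := by
    refine ⟨fun h u hu => h u (Submodule.subset_span hu), fun h u hu => ?_⟩
    induction hu using Submodule.span_induction with
    | mem u hu => exact h u hu
    | zero => simp
    | add x y _ _ hx hy => rw [inner_add_left, hx, hy, add_zero]
    | smul c x _ hx => rw [inner_smul_left, hx, mul_zero]
  rw [h1]
  simp only [penalized, mem_insert_iff, mem_singleton_iff, forall_eq_or_imp, forall_eq, BondRel, e,
    inner_add_left, inner_smul_left, EuclideanSpace.inner_single_left, map_one, one_mul, map_mul,
    Complex.conj_ofReal, map_pow]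

lemma mem_ker_hamiltonian_iff_bondRel (f : ℝ → ℝ) (g : ℝ → ℂ) (s : ℝ) (N a b : ℕ)
    (ψ : Chain (N + 1)) :
    ψ ∈ LinearMap.ker (hamiltonian f g s N a b) ↔
      ∀ x : Fin N, a ≤ x.val + 1 → x.val + 1 < b → ∀ σ,
        BondRel (f s) (starRingEnd ℂ (g s) * (Real.sin s / Real.cos s ^ 2 : ℝ))
          (fun i j => ψ (Function.update (Function.update σ x.castSucc i) x.succ j)) := by
  rw [mem_ker_hamiltonian]
  simp only [interaction_eq_zero_iff]
  rfl

/-! ### Ground states as amplitude functions, by recursion on the last site. -/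

/-- The bond relations at the bond `x`, for an amplitude function on a chain of `N + 1` sites. -/
def BondAt (f : ℝ) (κ : ℂ) {N : ℕ} (ψ : (Fin (N + 1) → Spin) → ℂ) (x : Fin N) : Prop :=
  ∀ σ, BondRel f κ (fun i j => ψ (Function.update (Function.update σ x.castSucc i) x.succ j))

lemma BondRel.zero (f : ℝ) (κ : ℂ) : BondRel f κ (fun _ _ => 0) := by
  simp [BondRel]

lemma BondRel.add {f : ℝ} {κ : ℂ} {v w : Spin → Spin → ℂ} (hv : BondRel f κ v)
    (hw : BondRel f κ w) : BondRel f κ (fun i j => v i j + w i j) := by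
  obtain ⟨h1, h2, h3, h4, h5⟩ := hv
  obtain ⟨k1, k2, k3, k4, k5⟩ := hw
  refine ⟨?_, ?_, ?_, ?_, ?_⟩
  · linear_combination h1 + k1
  · linear_combination h2 + k2
  · linear_combination h3 + k3
  · linear_combination h4 + k4
  · linear_combination h5 + k5

lemma BondRel.smul {f : ℝ} {κ : ℂ} {v : Spin → Spin → ℂ} (c : ℂ) (hv : BondRel f κ v) :
    BondRel f κ (fun i j => c * v i j) := by
  obtain ⟨h1, h2, h3, h4, h5⟩ := hv
  refine ⟨?_, ?_, ?_, ?_, ?_⟩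
  · linear_combination c * h1
  · linear_combination c * h2
  · linear_combination c * h3
  · linear_combination c * h4
  · linear_combination c * h5

/-- The amplitude functions that satisfy all bond relations. -/
def groundSpace (f : ℝ) (κ : ℂ) (N : ℕ) : Submodule ℂ ((Fin (N + 1) → Spin) → ℂ) where
  carrier := {ψ | ∀ x : Fin N, BondAt f κ ψ x}
  zero_mem' := fun _ _ => BondRel.zero f κ
  add_mem' := fun hv hw x σ => (hv x σ).add (hw x σ)
  smul_mem' := fun c _ hv x σ => (hv x σ).smul c

lemma mem_groundSpace {f : ℝ} {κ : ℂ} {N : ℕ} {ψ : (Fin (N + 1) → Spin) → ℂ} :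
    ψ ∈ groundSpace f κ N ↔ ∀ x : Fin N, BondAt f κ ψ x := Iff.rfl

lemma bondAt_castSucc {f : ℝ} {κ : ℂ} {N : ℕ} {ψ : (Fin (N + 2) → Spin) → ℂ} {x : Fin N} :
    BondAt f κ ψ x.castSucc ↔
      ∀ i : Spin, BondAt f κ (fun τ => ψ (Fin.snoc τ i)) x := by
  constructor
  · intro h i σ
    have := h (Fin.snoc σ i)
    rw [Fin.succ_castSucc] at this
    simpa only [← Fin.snoc_update] using this
  · intro h σ
    have := h (σ (Fin.last _)) (Fin.init σ)
    simp only [Fin.snoc_update] at this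
    rw [Fin.succ_castSucc]
    have h2 : Fin.snoc (Fin.init σ) (σ (Fin.last _)) = σ := Fin.snoc_init_self σ
    rwa [h2] at this

lemma bondAt_last {f : ℝ} {κ : ℂ} {N : ℕ} {ψ : (Fin (N + 2) → Spin) → ℂ} :
    BondAt f κ ψ (Fin.last N) ↔
      ∀ τ : Fin N → Spin, BondRel f κ (fun i j => ψ (Fin.snoc (Fin.snoc τ i) j)) := by
  have key : ∀ (τ : Fin N → Spin) (k l i j : Spin),
      Function.update (Function.update (Fin.snoc (α := fun _ => Spin)
        (Fin.snoc (α := fun _ => Spin) τ k) l) (Fin.last N).castSucc i) (Fin.last N).succ j =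
      Fin.snoc (α := fun _ => Spin) (Fin.snoc (α := fun _ => Spin) τ i) j := by
    intro τ k l i j
    rw [Fin.succ_last, ← Fin.snoc_update, Fin.update_snoc_last, Fin.update_snoc_last]
  constructor
  · intro h τ
    have := h (Fin.snoc (Fin.snoc τ 0) 0)
    simpa only [key] using this
  · intro h σ
    have h1 : σ = Fin.snoc (α := fun _ => Spin) (Fin.snoc (α := fun _ => Spin)
        (Fin.init (Fin.init σ)) (Fin.init σ (Fin.last _))) (σ (Fin.last _)) := by
      rw [Fin.snoc_init_self, Fin.snoc_init_self]
    rw [h1]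
    simp only [key]
    exact h _

lemma mem_groundSpace_succ {f : ℝ} {κ : ℂ} {N : ℕ} {ψ : (Fin (N + 2) → Spin) → ℂ} :
    ψ ∈ groundSpace f κ (N + 1) ↔
      (∀ i : Spin, (fun τ => ψ (Fin.snoc τ i)) ∈ groundSpace f κ N) ∧
      ∀ τ : Fin N → Spin, BondRel f κ (fun i j => ψ (Fin.snoc (Fin.snoc τ i) j)) := by
  rw [mem_groundSpace, Fin.forall_fin_succ', bondAt_last]
  simp only [bondAt_castSucc, mem_groundSpace]
  exact and_congr_left fun _ => forall_comm

lemma append_update_right {l m : ℕ} (σ : Fin l → Spin) (τ : Fin m → Spin) (y : Fin m) (i : Spin) :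
    Function.update (Fin.append σ τ) (Fin.natAdd l y) i =
      Fin.append σ (Function.update τ y i) := by
  ext z
  refine Fin.addCases (fun z => ?_) (fun z => ?_) z
  · have : Fin.castAdd m z ≠ Fin.natAdd l y := by
      intro h; have := congrArg Fin.val h; simp at this; omega
    simp [this]
  · by_cases h : z = y
    · subst h; simp
    · have : Fin.natAdd l z ≠ Fin.natAdd l y := by
        intro h2; exact h (by simpa using h2)
      simp [this, h]

lemma bondAt_natAdd {f : ℝ} {κ : ℂ} {l m : ℕ} {ψ : (Fin (l + m + 1) → Spin) → ℂ} {y : Fin m}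
    (h : BondAt f κ ψ (Fin.natAdd l y)) (σ : Fin l → Spin) :
    BondAt f κ (fun τ : Fin (m + 1) → Spin => ψ (Fin.append (m := l) (n := m + 1) σ τ)) y := by
  intro τ
  have := h (Fin.append (m := l) (n := m + 1) σ τ)
  have e1 : (Fin.natAdd l y).castSucc = Fin.natAdd l y.castSucc := rfl
  have e2 : (Fin.natAdd l y).succ = Fin.natAdd l y.succ := rfl
  rw [e1, e2] at this
  simpa only [← append_update_right] using this

/-- The configuration `-, 0, …, 0`. -/
def minusZeros : (n : ℕ) → Fin (n + 1) → Spin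
  | 0 => fun _ => -1
  | n + 1 => Fin.snoc (minusZeros n) 0

lemma zeros_succ (n : ℕ) : (0 : Fin (n + 1) → Spin) = Fin.snoc (0 : Fin n → Spin) 0 := by
  ext z
  refine Fin.lastCases ?_ (fun z => ?_) z
  · simp
  · simp

lemma fn_snoc_ext {n : ℕ} {ψ φ : (Fin (n + 1) → Spin) → ℂ}
    (h : ∀ i, (fun τ : Fin n → Spin => ψ (Fin.snoc τ i)) = fun τ => φ (Fin.snoc τ i)) : ψ = φ := by
  funext τ
  rw [← Fin.snoc_init_self τ]
  exact congrFun (h (τ (Fin.last n))) (Fin.init τ)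

lemma spin_forall {P : Spin → Prop} (h0 : P 0) (h1 : P 1) (h2 : P (-1)) : ∀ i, P i := by
  intro i
  cases i
  · exact h0
  · exact h2
  · exact h1

/-- At the last bond the relations express the amplitudes (0,-), (+,-), (-,-) through amplitudes
whose last spin is 0 or +. -/
lemma groundSpace_minus_slice {f : ℝ} {κ : ℂ} {n : ℕ} {ψ : (Fin (n + 2) → Spin) → ℂ}
    (hψ : ψ ∈ groundSpace f κ (n + 1)) (h0 : ∀ τ, ψ (Fin.snoc τ 0) = 0)
    (h1 : ∀ τ, ψ (Fin.snoc τ 1) = 0) : ψ = 0 := by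
  have hb := (mem_groundSpace_succ.1 hψ).2
  refine fn_snoc_ext (spin_forall (funext h0) (funext h1) (fn_snoc_ext (spin_forall ?_ ?_ ?_))) <;>
    funext τ <;> obtain ⟨r1, r2, r3, r4, r5⟩ := hb τ <;> beta_reduce at r1 r2 r3 r4 r5 <;>
    change _ = (0 : ℂ)
  · rw [h0] at r4
    simpa using r4
  · rw [h0, h1] at r5
    simpa using r5
  · exact r2

/-- The ground space has dimension at most four. The slices with last spin 0 and + are ground states
of a shorter chain. Of their four test amplitudes, two are assumed to vanish, and two vanish by the
relations for (+,0) and (+,+) at the last bond. -/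
theorem groundSpace_eq_zero {f : ℝ} {κ : ℂ} : ∀ {n : ℕ} {ψ : (Fin (n + 2) → Spin) → ℂ},
    ψ ∈ groundSpace f κ (n + 1) → ψ 0 = 0 → ψ (Fin.snoc 0 1) = 0 → ψ (minusZeros (n + 1)) = 0 →
    ψ (Fin.snoc (minusZeros n) 1) = 0 → ψ = 0
  | 0, ψ, hψ, h1, h2, h3, h4 => by
    have hb := (mem_groundSpace_succ.1 hψ).2
    have hz : (0 : Fin 1 → Spin) = Fin.snoc (α := fun _ => Spin) (0 : Fin 0 → Spin) 0 :=
      zeros_succ 0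
    have hm : minusZeros 0 = Fin.snoc (α := fun _ => Spin) (0 : Fin 0 → Spin) (-1) := by
      ext z; fin_cases z; rfl
    obtain ⟨r1, r2, r3, r4, r5⟩ := hb 0
    beta_reduce at r1 r2 r3 r4 r5
    rw [zeros_succ, hz] at h1
    rw [hz] at h2
    rw [minusZeros, hm] at h3
    rw [hm] at h4
    refine groundSpace_minus_slice hψ (fun τ => ?_) (fun τ => ?_)
    · rw [← Fin.snoc_init_self τ, Subsingleton.elim (Fin.init τ) (0 : Fin 0 → Spin)]
      refine spin_forall (P := fun i => ψ (Fin.snoc (Fin.snoc 0 i) 0) = 0) h1 ?_ h3 _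
      rwa [h2, mul_zero, add_zero] at r3
    · rw [← Fin.snoc_init_self τ, Subsingleton.elim (Fin.init τ) (0 : Fin 0 → Spin)]
      exact spin_forall (P := fun i => ψ (Fin.snoc (Fin.snoc 0 i) 1) = 0) h2 r1 h4 _
  | n + 1, ψ, hψ, h1, h2, h3, h4 => by
    obtain ⟨hs, hb⟩ := mem_groundSpace_succ.1 hψ
    refine groundSpace_minus_slice hψ
      (fun τ => congrFun (groundSpace_eq_zero (hs 0) ?_ ?_ ?_ ?_) τ)
      (fun τ => congrFun (groundSpace_eq_zero (hs 1) ?_ ?_ ?_ ?_) τ)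
    · rwa [← zeros_succ]
    · have r3 := (hb 0).2.2.1
      beta_reduce at r3
      rw [← zeros_succ, h2] at r3
      simpa using r3
    · exact h3
    · have r3 := (hb (minusZeros n)).2.2.1
      beta_reduce at r3
      rw [← minusZeros, h4] at r3
      simpa using r3
    · exact h2
    · exact (hb 0).1
    · exact h4
    · exact (hb (minusZeros n)).1

/-- The amplitude function on `n + 1` sites whose slices at the last site are given. -/
def joinLast {n : ℕ} (x₀ x₁ x₂ : (Fin n → Spin) → ℂ) : (Fin (n + 1) → Spin) → ℂ := fun τ =>
  match τ (Fin.last n) with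
  | .zero => x₀ (Fin.init τ)
  | .pos => x₁ (Fin.init τ)
  | .neg => x₂ (Fin.init τ)

section joinLast
variable {n : ℕ} (x₀ x₁ x₂ : (Fin n → Spin) → ℂ) (τ : Fin n → Spin)

@[simp] lemma joinLast_zero : joinLast x₀ x₁ x₂ (Fin.snoc τ 0) = x₀ τ := by
  simp only [joinLast, Fin.snoc_last, Fin.init_snoc]

@[simp] lemma joinLast_one : joinLast x₀ x₁ x₂ (Fin.snoc τ 1) = x₁ τ := by
  simp only [joinLast, Fin.snoc_last, Fin.init_snoc]

@[simp] lemma joinLast_neg_one : joinLast x₀ x₁ x₂ (Fin.snoc τ (-1)) = x₂ τ := by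
  simp only [joinLast, Fin.snoc_last, Fin.init_snoc]

end joinLast

/-! ### The matrix product basis. -/

/-- A basis of the ground space of `n` sites, given by recursion on the last site. With the
matrices `A₊ = a E₁₂`, `A₋ = b E₂₁`, `A₀ = diag(p, -f p)` and the matrix product amplitudes `Ψᵢⱼ`,
its members are `Ψ₁₁`, `Ψ₁₂`, `Ψ₂₁ / b` and `(Ψ₂₂ - uⁿ Ψ₁₁) / b`, where `u = -f p²`. The recursion
is meaningful for `b = 0` as well. -/
def mps (p b f : ℝ) (a : ℂ) : (n : ℕ) → Fin 4 → (Fin n → Spin) → ℂ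
  | 0 => ![fun _ => 1, 0, 0, 0]
  | n + 1 =>
    ![joinLast ((p : ℂ) • mps p b f a n 0) 0 ((b : ℂ) • mps p b f a n 1),
      joinLast ((-f * p : ℂ) • mps p b f a n 1) (a • mps p b f a n 0) 0,
      joinLast ((p : ℂ) • mps p b f a n 2) 0
        ((-f * p ^ 2 : ℂ) ^ n • mps p b f a n 0 + (b : ℂ) • mps p b f a n 3),
      joinLast ((-f * p : ℂ) • mps p b f a n 3 +
          (-f * p * b * (-f * p ^ 2) ^ n : ℂ) • mps p b f a n 0)
        (a • mps p b f a n 2) (-(-f * p ^ 2 : ℂ) ^ (n + 1) • mps p b f a n 1)]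

section mps
variable {p b f : ℝ} {a : ℂ}

lemma mps_zero (q : Fin 4) :
    mps p b f a 0 q = (![fun _ => 1, 0, 0, 0] : Fin 4 → (Fin 0 → Spin) → ℂ) q := rfl

lemma mps_succ_zero (n : ℕ) : mps p b f a (n + 1) 0 =
    joinLast ((p : ℂ) • mps p b f a n 0) 0 ((b : ℂ) • mps p b f a n 1) := rfl

lemma mps_succ_one (n : ℕ) : mps p b f a (n + 1) 1 =
    joinLast ((-f * p : ℂ) • mps p b f a n 1) (a • mps p b f a n 0) 0 := rfl

lemma mps_succ_two (n : ℕ) : mps p b f a (n + 1) 2 =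
    joinLast ((p : ℂ) • mps p b f a n 2) 0
        ((-f * p ^ 2 : ℂ) ^ n • mps p b f a n 0 + (b : ℂ) • mps p b f a n 3) := rfl

lemma mps_succ_three (n : ℕ) : mps p b f a (n + 1) 3 =
    joinLast ((-f * p : ℂ) • mps p b f a n 3 +
          (-f * p * b * (-f * p ^ 2) ^ n : ℂ) • mps p b f a n 0)
        (a • mps p b f a n 2) (-(-f * p ^ 2 : ℂ) ^ (n + 1) • mps p b f a n 1) := rfl

lemma groundSpace_joinLast {κ : ℂ} {N : ℕ} {x₀ x₁ x₂ : (Fin (N + 1) → Spin) → ℂ}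
    (h₀ : x₀ ∈ groundSpace f κ N) (h₁ : x₁ ∈ groundSpace f κ N) (h₂ : x₂ ∈ groundSpace f κ N)
    (hb : ∀ τ : Fin N → Spin,
      BondRel f κ (fun i j => joinLast x₀ x₁ x₂ (Fin.snoc (Fin.snoc τ i) j))) :
    joinLast x₀ x₁ x₂ ∈ groundSpace f κ (N + 1) := by
  refine mem_groundSpace_succ.2 ⟨spin_forall ?_ ?_ ?_, hb⟩
  · simpa using h₀
  · simpa using h₁
  · simpa using h₂

/-- The matrices satisfy the bond relations as matrix identities: A₊A₀ + f A₀A₊ = 0, and A₊A₋ + κA₀²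
+ f²A₋A₊ = 0 reduces to `hκ`. The hypothesis `hpb` enters through the members that were divided by
b. -/
theorem mps_mem_groundSpace {κ : ℂ} (hpb : p ^ 2 + b ^ 2 = 1) (hκ : a * b + κ * p ^ 2 = 0) :
    ∀ (n : ℕ) (q : Fin 4), mps p b f a (n + 1) q ∈ groundSpace f κ n
  | 0, q => fun x => x.elim0
  | n + 1, q => by
    have ih := mps_mem_groundSpace hpb hκ n
    have hpb' : (p : ℂ) ^ 2 + (b : ℂ) ^ 2 = 1 := by exact_mod_cast hpb
    have i0 := ih 0
    have i1 := ih 1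
    have i2 := ih 2
    have i3 := ih 3
    fin_cases q
    · refine groundSpace_joinLast (Submodule.smul_mem _ _ i0) (Submodule.zero_mem _)
        (Submodule.smul_mem _ _ i1) fun τ => ⟨?_, ?_, ?_, ?_, ?_⟩ <;>
        simp [mps_succ_zero, mps_succ_one]
      · ring
      · linear_combination (mps p b f a n 0 τ) * hκ
    · refine groundSpace_joinLast (Submodule.smul_mem _ _ i1) (Submodule.smul_mem _ _ i0)
        (Submodule.zero_mem _) fun τ => ⟨?_, ?_, ?_, ?_, ?_⟩ <;>
        simp [mps_succ_zero, mps_succ_one]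
      · ring
      · linear_combination (f ^ 2 * mps p b f a n 1 τ) * hκ
    · refine groundSpace_joinLast (Submodule.smul_mem _ _ i2) (Submodule.zero_mem _)
        (Submodule.add_mem _ (Submodule.smul_mem _ _ i0) (Submodule.smul_mem _ _ i3))
        fun τ => ⟨?_, ?_, ?_, ?_, ?_⟩ <;>
        simp [mps_succ_zero, mps_succ_two, mps_succ_three]
      · ring
      · linear_combination (-(f : ℂ) * p * (-f * p ^ 2) ^ n * mps p b f a n 0 τ) * hpb'
      · linear_combination (mps p b f a n 2 τ) * hκ
    · refine groundSpace_joinLast (Submodule.add_mem _ (Submodule.smul_mem _ _ i3)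
          (Submodule.smul_mem _ _ i0)) (Submodule.smul_mem _ _ i2)
        (Submodule.smul_mem _ _ i1) fun τ => ⟨?_, ?_, ?_, ?_, ?_⟩ <;>
        simp [mps_succ_zero, mps_succ_one, mps_succ_two, mps_succ_three]
      · ring
      · linear_combination (f ^ 3 * p ^ 3 * (-f * p ^ 2) ^ n * mps p b f a n 1 τ) * hpb'
      · linear_combination (f ^ 2 * mps p b f a n 3 τ +
          f ^ 2 * (-f * p ^ 2) ^ n * mps p b f a n 0 τ * b * (1 + p ^ 2)) * hκ -
          (f ^ 2 * (-f * p ^ 2) ^ n * mps p b f a n 0 τ * a * (1 + p ^ 2)) * hpb'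

/-- Amplitudes of the basis at the configurations that determine a ground state. -/
lemma mps_zeros (n : ℕ) : mps p b f a n 0 0 = (p : ℂ) ^ n ∧ mps p b f a n 1 0 = 0 ∧
    mps p b f a n 2 0 = 0 := by
  induction n with
  | zero => simp [mps_zero]
  | succ n ih =>
    obtain ⟨h0, h1, h2⟩ := ih
    rw [zeros_succ]
    simp [mps_succ_zero, mps_succ_one, mps_succ_two, h0, h1, h2]
    ring

lemma mps_minusZeros (n : ℕ) : mps p b f a (n + 1) 0 (minusZeros n) = 0 ∧
    mps p b f a (n + 1) 1 (minusZeros n) = 0 ∧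
    mps p b f a (n + 1) 2 (minusZeros n) = (p : ℂ) ^ n ∧
    mps p b f a (n + 1) 3 (minusZeros n) = 0 := by
  induction n with
  | zero =>
    have hm : minusZeros 0 = Fin.snoc (α := fun _ => Spin) (0 : Fin 0 → Spin) (-1) := by
      ext z; fin_cases z; rfl
    rw [hm]
    simp only [mps_succ_zero, mps_succ_one, mps_succ_two, mps_succ_three, joinLast_neg_one]
    simp [mps_zero]
  | succ n ih =>
    obtain ⟨h0, h1, h2, h3⟩ := ih
    rw [minusZeros, mps_succ_zero (n + 1), mps_succ_one (n + 1), mps_succ_two (n + 1),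
      mps_succ_three (n + 1)]
    simp [h0, h1, h2, h3]
    ring

/-- At the four test configurations the basis has a triangular matrix of values, with diagonal
entries p^(n+2), a p^(n+1), p^(n+1), a p^n. Only the fourth member contributes off the diagonal, at
the all-zero configuration, hence the correction by `c₃`. -/
theorem exists_mps_coeff {κ : ℂ} (hpb : p ^ 2 + b ^ 2 = 1) (hκ : a * b + κ * p ^ 2 = 0)
    (hp : p ≠ 0) (ha : a ≠ 0) {n : ℕ} {ψ : (Fin (n + 2) → Spin) → ℂ}
    (hψ : ψ ∈ groundSpace f κ (n + 1)) :
    ∃ c : Fin 4 → ℂ, ψ = ∑ q, c q • mps p b f a (n + 2) q := by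
  have hp' : (p : ℂ) ≠ 0 := by exact_mod_cast hp
  obtain ⟨z0, z1, z2⟩ := mps_zeros (p := p) (b := b) (f := f) (a := a) (n + 2)
  obtain ⟨z0', z1', z2'⟩ := mps_zeros (p := p) (b := b) (f := f) (a := a) (n + 1)
  obtain ⟨m0, m1, m2, m3⟩ := mps_minusZeros (p := p) (b := b) (f := f) (a := a) (n + 1)
  obtain ⟨m0', m1', m2', m3'⟩ := mps_minusZeros (p := p) (b := b) (f := f) (a := a) n
  let c₃ : ℂ := ψ (Fin.snoc (minusZeros n) 1) / (a * p ^ n)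
  let c : Fin 4 → ℂ := ![(ψ 0 - c₃ * mps p b f a (n + 2) 3 0) / p ^ (n + 2),
    ψ (Fin.snoc 0 1) / (a * p ^ (n + 1)), ψ (minusZeros (n + 1)) / p ^ (n + 1), c₃]
  refine ⟨c, sub_eq_zero.1 (groundSpace_eq_zero (κ := κ) (f := f) ?_ ?_ ?_ ?_ ?_)⟩
  · exact Submodule.sub_mem _ hψ (Submodule.sum_mem _ fun q _ =>
      Submodule.smul_mem _ _ (mps_mem_groundSpace hpb hκ (n + 1) q))
  · simp [Fin.sum_univ_four, c, z0, z1, z2]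
    field_simp
    ring
  · simp [Fin.sum_univ_four, c, mps_succ_zero (n + 1), mps_succ_one (n + 1),
      mps_succ_two (n + 1), mps_succ_three (n + 1), z0', z2']
    field_simp
    ring
  · simp [Fin.sum_univ_four, c, m0, m1, m2, m3]
    field_simp
    ring
  · simp [Fin.sum_univ_four, c, mps_succ_zero (n + 1), mps_succ_one (n + 1),
      mps_succ_two (n + 1), mps_succ_three (n + 1), m0', m2', c₃]
    field_simp
    ring

/-- Splitting a chain in two. -/
theorem mps_append (hpb : p ^ 2 + b ^ 2 = 1) (l : ℕ) (σ : Fin l → Spin) : ∀ (m : ℕ)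
    (τ : Fin m → Spin),
    mps p b f a (l + m) 0 (Fin.append σ τ) =
      mps p b f a l 0 σ * mps p b f a m 0 τ + b * mps p b f a l 1 σ * mps p b f a m 2 τ ∧
    mps p b f a (l + m) 1 (Fin.append σ τ) =
      mps p b f a l 0 σ * mps p b f a m 1 τ + mps p b f a l 1 σ *
        ((-f * p ^ 2 : ℂ) ^ m * mps p b f a m 0 τ + b * mps p b f a m 3 τ) ∧
    mps p b f a (l + m) 2 (Fin.append σ τ) =
      mps p b f a l 2 σ * mps p b f a m 0 τ +
        ((-f * p ^ 2 : ℂ) ^ l * mps p b f a l 0 σ + b * mps p b f a l 3 σ) *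
          mps p b f a m 2 τ ∧
    mps p b f a (l + m) 3 (Fin.append σ τ) =
      mps p b f a l 2 σ * mps p b f a m 1 τ + mps p b f a l 3 σ *
        ((-f * p ^ 2 : ℂ) ^ m * mps p b f a m 0 τ + b * mps p b f a m 3 τ) +
        (-f * p ^ 2 : ℂ) ^ l * mps p b f a l 0 σ * mps p b f a m 3 τ -
        (-f * p ^ 2 : ℂ) ^ (l + m) * mps p b f a l 1 σ * mps p b f a m 2 τ
  | 0, τ => by
    have hτ : Fin.append σ τ = σ := by
      rw [Subsingleton.elim τ Fin.elim0, Fin.append_elim0]; rfl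
    simp only [Nat.add_zero, hτ, mps_zero]
    simp
  | m + 1, τ => by
    have hpb' : (p : ℂ) ^ 2 + (b : ℂ) ^ 2 = 1 := by exact_mod_cast hpb
    rw [← Fin.snoc_init_self τ, Fin.append_snoc]
    obtain ⟨h0, h1, h2, h3⟩ := mps_append hpb l σ m (Fin.init τ)
    generalize Fin.init τ = τ' at *
    have hlm : ∀ q (x : Fin (l + m + 1) → Spin),
        mps p b f a (l + (m + 1)) q x = mps p b f a (l + m + 1) q x := fun _ _ => rfl
    rw [hlm 0, hlm 1, hlm 2, hlm 3]
    generalize τ (Fin.last m) = i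
    revert i
    refine spin_forall ?_ ?_ ?_
    · simp only [mps_succ_zero, mps_succ_one, mps_succ_two, mps_succ_three, joinLast_zero,
        Pi.smul_apply, Pi.add_apply, smul_eq_mul, h0, h1, h2, h3, pow_add, pow_one]
      generalize (-f * p ^ 2 : ℂ) ^ l = ul
      generalize (-f * p ^ 2 : ℂ) ^ m = um
      refine ⟨?_, ?_, ?_, ?_⟩
      · ring
      · linear_combination (f * p * um * mps p b f a l 1 σ * mps p b f a m 0 τ') * hpb'
      · ring
      · linear_combination (f * p * um * (mps p b f a l 3 σ * mps p b f a m 0 τ' -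
          ul * mps p b f a l 1 σ * mps p b f a m 2 τ')) * hpb'
    · simp only [mps_succ_zero, mps_succ_one, mps_succ_two, mps_succ_three, joinLast_one,
        Pi.smul_apply, smul_eq_mul, h0, h2, pow_add, pow_one, Pi.zero_apply]
      refine ⟨?_, ?_, ?_, ?_⟩ <;> ring
    · simp only [mps_succ_zero, mps_succ_one, mps_succ_two, mps_succ_three, joinLast_neg_one,
        Pi.smul_apply, Pi.add_apply, smul_eq_mul, h0, h1, h3, pow_add, pow_one, Pi.zero_apply]
      refine ⟨?_, ?_, ?_, ?_⟩ <;> ring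

end mps

/-! ### The Gram matrix of the basis and its limit. -/

/-- The inner product of amplitude functions. -/
noncomputable def ampInner {n : ℕ} (ψ φ : (Fin n → Spin) → ℂ) : ℂ :=
  ∑ τ, starRingEnd ℂ (ψ τ) * φ τ

section ampInner
variable {n : ℕ} (ψ φ χ : (Fin n → Spin) → ℂ) (c : ℂ)

lemma ampInner_add_left : ampInner (ψ + φ) χ = ampInner ψ χ + ampInner φ χ := by
  simp [ampInner, add_mul, Finset.sum_add_distrib]

lemma ampInner_add_right : ampInner ψ (φ + χ) = ampInner ψ φ + ampInner ψ χ := by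
  simp [ampInner, mul_add, Finset.sum_add_distrib]

lemma ampInner_smul_left : ampInner (c • ψ) φ = starRingEnd ℂ c * ampInner ψ φ := by
  simp [ampInner, Finset.mul_sum, mul_assoc]

lemma ampInner_smul_right : ampInner ψ (c • φ) = c * ampInner ψ φ := by
  simp only [ampInner, Finset.mul_sum, Pi.smul_apply, smul_eq_mul]
  exact Finset.sum_congr rfl fun _ _ => by ring

lemma ampInner_zero_left : ampInner 0 φ = 0 := by simp [ampInner]

lemma ampInner_zero_right : ampInner ψ 0 = 0 := by simp [ampInner]

lemma ampInner_conj : starRingEnd ℂ (ampInner ψ φ) = ampInner φ ψ := by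
  simp only [ampInner, map_sum, map_mul, Complex.conj_conj]
  exact Finset.sum_congr rfl fun _ _ => mul_comm _ _

lemma ampInner_self : ampInner ψ ψ = ((∑ τ, ‖ψ τ‖ ^ 2 : ℝ) : ℂ) := by
  simp [ampInner, Complex.conj_mul']

end ampInner

lemma sum_snoc {M : Type*} [AddCommMonoid M] {n : ℕ} (F : (Fin (n + 1) → Spin) → M) :
    ∑ τ, F τ = ∑ i : Spin, ∑ τ : Fin n → Spin, F (Fin.snoc τ i) := by
  rw [← Equiv.sum_comp (Fin.snocEquiv (fun _ : Fin (n + 1) => Spin)) F, Fintype.sum_prod_type]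
  rfl

lemma sum_spin {M : Type*} [AddCommMonoid M] (F : Spin → M) :
    ∑ i, F i = F 0 + F 1 + F (-1) := by
  have : (Finset.univ : Finset SignType) = {0, 1, -1} := by decide
  rw [this, Finset.sum_insert (by decide), Finset.sum_insert (by decide), Finset.sum_singleton,
    add_assoc]

lemma sum_append {M : Type*} [AddCommMonoid M] {l m : ℕ} (F : (Fin (l + m) → Spin) → M) :
    ∑ τ, F τ = ∑ σ : Fin l → Spin, ∑ τ : Fin m → Spin, F (Fin.append σ τ) := by
  rw [← Equiv.sum_comp (Fin.appendEquiv l m) F, Fintype.sum_prod_type]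
  rfl

lemma ampInner_snoc {n : ℕ} (ψ φ : (Fin (n + 1) → Spin) → ℂ) :
    ampInner ψ φ = ampInner (fun τ => ψ (Fin.snoc τ 0)) (fun τ => φ (Fin.snoc τ 0)) +
      ampInner (fun τ => ψ (Fin.snoc τ 1)) (fun τ => φ (Fin.snoc τ 1)) +
      ampInner (fun τ => ψ (Fin.snoc τ (-1))) (fun τ => φ (Fin.snoc τ (-1))) := by
  simp only [ampInner]
  rw [sum_snoc, sum_spin]

lemma ampInner_joinLast {n : ℕ} (x₀ x₁ x₂ : (Fin n → Spin) → ℂ)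
    (φ : (Fin (n + 1) → Spin) → ℂ) :
    ampInner (joinLast x₀ x₁ x₂) φ = ampInner x₀ (fun τ => φ (Fin.snoc τ 0)) +
      ampInner x₁ (fun τ => φ (Fin.snoc τ 1)) + ampInner x₂ (fun τ => φ (Fin.snoc τ (-1))) := by
  rw [ampInner_snoc]
  simp only [joinLast_zero, joinLast_one, joinLast_neg_one]

lemma ampInner_joinLast_joinLast {n : ℕ} (x₀ x₁ x₂ y₀ y₁ y₂ : (Fin n → Spin) → ℂ) :
    ampInner (joinLast x₀ x₁ x₂) (joinLast y₀ y₁ y₂) =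
      ampInner x₀ y₀ + ampInner x₁ y₁ + ampInner x₂ y₂ := by
  rw [ampInner_joinLast]
  simp only [joinLast_zero, joinLast_one, joinLast_neg_one]

/-- The geometric sum `∑_{j<n} tʲ`. -/
def geomSum (t : ℝ) : ℕ → ℝ
  | 0 => 0
  | n + 1 => geomSum t n + t ^ n

/-- The divided difference `∑_{j<n} vʲ tⁿ⁻¹⁻ʲ` of `xⁿ`. -/
def powDiff (v t : ℝ) : ℕ → ℝ
  | 0 => 0
  | n + 1 => v * powDiff v t n + t ^ n

lemma geomSum_mul (t : ℝ) (n : ℕ) : geomSum t n * (1 - t) = 1 - t ^ n := by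
  induction n with
  | zero => simp [geomSum]
  | succ n ih => rw [geomSum, pow_succ]; linear_combination ih

lemma powDiff_mul (v t : ℝ) (n : ℕ) : (v - t) * powDiff v t n = v ^ n - t ^ n := by
  induction n with
  | zero => simp [powDiff]
  | succ n ih => rw [powDiff, pow_succ, pow_succ]; linear_combination v * ih

/-- The Gram matrix of four vectors, in the shape that the matrix product basis has. -/
structure IsGram {n : ℕ} (v : Fin 4 → (Fin n → Spin) → ℂ) (α β γ ξ ω : ℝ) : Prop where
  h00 : ampInner (v 0) (v 0) = α
  h11 : ampInner (v 1) (v 1) = β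
  h22 : ampInner (v 2) (v 2) = γ
  h33 : ampInner (v 3) (v 3) = ξ
  h03 : ampInner (v 0) (v 3) = ω
  h30 : ampInner (v 3) (v 0) = ω
  h01 : ampInner (v 0) (v 1) = 0
  h10 : ampInner (v 1) (v 0) = 0
  h02 : ampInner (v 0) (v 2) = 0
  h20 : ampInner (v 2) (v 0) = 0
  h12 : ampInner (v 1) (v 2) = 0
  h21 : ampInner (v 2) (v 1) = 0
  h13 : ampInner (v 1) (v 3) = 0
  h31 : ampInner (v 3) (v 1) = 0
  h23 : ampInner (v 2) (v 3) = 0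
  h32 : ampInner (v 3) (v 2) = 0

lemma IsGram.mk' {n : ℕ} {v : Fin 4 → (Fin n → Spin) → ℂ} {α β γ ξ ω : ℝ}
    (h00 : ampInner (v 0) (v 0) = α) (h11 : ampInner (v 1) (v 1) = β)
    (h22 : ampInner (v 2) (v 2) = γ) (h33 : ampInner (v 3) (v 3) = ξ)
    (h03 : ampInner (v 0) (v 3) = ω) (h01 : ampInner (v 0) (v 1) = 0)
    (h02 : ampInner (v 0) (v 2) = 0) (h12 : ampInner (v 1) (v 2) = 0)
    (h13 : ampInner (v 1) (v 3) = 0) (h23 : ampInner (v 2) (v 3) = 0) : IsGram v α β γ ξ ω where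
  h00 := h00
  h11 := h11
  h22 := h22
  h33 := h33
  h03 := h03
  h01 := h01
  h02 := h02
  h12 := h12
  h13 := h13
  h23 := h23
  h30 := by rw [← ampInner_conj, h03, Complex.conj_ofReal]
  h10 := by rw [← ampInner_conj, h01, map_zero]
  h20 := by rw [← ampInner_conj, h02, map_zero]
  h21 := by rw [← ampInner_conj, h12, map_zero]
  h31 := by rw [← ampInner_conj, h13, map_zero]
  h32 := by rw [← ampInner_conj, h23, map_zero]

/-- The Gram matrix of the matrix product basis. -/
theorem mps_isGram {p b f A : ℝ} {a : ℂ} (hpb : p ^ 2 + b ^ 2 = 1) (hA : A = 1 - f ^ 2 * p ^ 2)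
    (ha : starRingEnd ℂ a * a = A) (n : ℕ) :
    IsGram (mps p b f a n) (1 - b ^ 2 * geomSum (f ^ 2 * p ^ 2 - b ^ 2) n)
      (A * geomSum (f ^ 2 * p ^ 2 - b ^ 2) n) (geomSum (f ^ 2 * p ^ 2 - b ^ 2) n)
      (geomSum (f ^ 2 * p ^ 2 - b ^ 2) n * (1 - ((-f * p ^ 2) ^ n) ^ 2) -
        A * powDiff ((-f * p ^ 2) ^ 2) (f ^ 2 * p ^ 2 - b ^ 2) n)
      ((-f * p ^ 2) ^ n * b * geomSum (f ^ 2 * p ^ 2 - b ^ 2) n) := by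
  induction n with
  | zero =>
    refine IsGram.mk' ?_ ?_ ?_ ?_ ?_ ?_ ?_ ?_ ?_ ?_ <;>
      simp [mps_zero, ampInner, geomSum, powDiff]
  | succ n ih =>
    have hR : geomSum (f ^ 2 * p ^ 2 - b ^ 2) n * (1 - (f ^ 2 * p ^ 2 - b ^ 2)) =
        1 - (f ^ 2 * p ^ 2 - b ^ 2) ^ n := geomSum_mul _ n
    have hT : ((-f * p ^ 2) ^ 2 - (f ^ 2 * p ^ 2 - b ^ 2)) *
        powDiff ((-f * p ^ 2) ^ 2) (f ^ 2 * p ^ 2 - b ^ 2) n =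
        ((-f * p ^ 2) ^ 2) ^ n - (f ^ 2 * p ^ 2 - b ^ 2) ^ n := powDiff_mul _ _ n
    rw [pow_right_comm] at hT
    rw [geomSum, powDiff]
    obtain ⟨h00, h11, h22, h33, h03, h30, h01, h10, h02, h20, h12, h21, h13, h31, h23, h32⟩ := ih
    have ea : ∀ x : ℂ, a * (starRingEnd ℂ a * x) = A * x := fun x => by
      rw [← mul_assoc, mul_comm a, ha]
    generalize hg : geomSum (f ^ 2 * p ^ 2 - b ^ 2) n = g at *
    generalize hd : powDiff ((-f * p ^ 2) ^ 2) (f ^ 2 * p ^ 2 - b ^ 2) n = d at *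
    generalize hU : (-f * p ^ 2 : ℝ) ^ n = U at *
    generalize hTn : (f ^ 2 * p ^ 2 - b ^ 2) ^ n = T at *
    have hUc : (-(f : ℂ) * p ^ 2) ^ n = U := by rw [← hU]; push_cast; rfl
    have hp2 : (p : ℂ) ^ 2 + b ^ 2 = 1 := by exact_mod_cast hpb
    have hRc : (g : ℂ) * (1 - (f ^ 2 * p ^ 2 - b ^ 2)) = 1 - T := by exact_mod_cast hR
    have hTc : ((-f * p ^ 2 : ℂ) ^ 2 - (f ^ 2 * p ^ 2 - b ^ 2)) * d = U ^ 2 - T := by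
      exact_mod_cast hT
    have hAc : (A : ℂ) = 1 - f ^ 2 * p ^ 2 := by rw [hA]; push_cast; rfl
    refine IsGram.mk' ?_ ?_ ?_ ?_ ?_ ?_ ?_ ?_ ?_ ?_ <;>
      simp only [mps_succ_zero, mps_succ_one, mps_succ_two, mps_succ_three,
        ampInner_joinLast_joinLast, ampInner_add_left, ampInner_add_right, ampInner_smul_left,
        ampInner_smul_right, ampInner_zero_left, ampInner_zero_right, h00, h11, h22, h33, h03,
        h30, h01, h10, h02, h20, h12, h13, h31, h23, pow_succ _ n, hUc, hU,
        map_mul, map_neg, map_pow, Complex.conj_ofReal, ea, mul_zero, add_zero, Complex.ofReal_sub,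
        Complex.ofReal_mul, Complex.ofReal_pow, Complex.ofReal_one, Complex.ofReal_add,
        Complex.ofReal_neg]
    · linear_combination (1 - b ^ 2 * g) * hp2 + b ^ 2 * g * hAc + b ^ 2 * hRc
    · linear_combination (-A : ℂ) * hRc
    · linear_combination (g + d * f ^ 2 * p ^ 2) * hp2 - hTc - d * b ^ 2 * hAc
    · clear * - hp2 hRc hTc hAc
      grind
    · clear * - hp2 hRc hTc hAc
      grind

/-- The Gram data `(α, β, γ, ξ, ω)` are within `η` of `(A Γ, A Γ, Γ, Γ, 0)`. -/
structure NearLimit (A Γ η α β γ ξ ω : ℝ) : Prop where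
  hα : |α - A * Γ| ≤ η
  hβ : |β - A * Γ| ≤ η
  hγ : |γ - Γ| ≤ η
  hξ : |ξ - Γ| ≤ η
  hω : |ω| ≤ η

/-- A sum of n monomials of degree n - 1; the truncated exponent at n = 0 is harmless because of the
factor n. -/
lemma abs_powDiff_le {v t ε : ℝ} (hε : 0 ≤ ε) (hv : |v| ≤ ε) (ht : |t| ≤ ε) (n : ℕ) :
    |powDiff v t n| ≤ n * ε ^ (n - 1) := by
  induction n with
  | zero => simp [powDiff]
  | succ n ih =>
    have h1 : |t ^ n| ≤ ε ^ n := by rw [abs_pow]; exact pow_le_pow_left₀ (abs_nonneg _) ht n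
    have h2 : |v| * |powDiff v t n| ≤ n * ε ^ n := by
      rcases n with _ | n
      · simp [powDiff]
      · calc |v| * |powDiff v t (n + 1)| ≤ ε * (((n + 1 : ℕ) : ℝ) * ε ^ n) :=
            mul_le_mul hv ih (abs_nonneg _) hε
          _ = _ := by ring
    rw [powDiff, Nat.add_sub_cancel]
    calc |v * powDiff v t n + t ^ n| ≤ |v * powDiff v t n| + |t ^ n| := abs_add_le _ _
      _ ≤ n * ε ^ n + ε ^ n := by rw [abs_mul]; exact add_le_add h2 h1
      _ = _ := by push_cast; ring

/-- Half of the decay is spent on the factor n: nε^n = (n√ε^n) · √ε^n with a bounded first factor.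
This is where the rate √ε comes from. -/
lemma exists_mul_pow_le_sqrt_pow {ε : ℝ} (hε : 0 < ε) (hε1 : ε < 1) :
    ∃ K : ℝ, 0 ≤ K ∧ ∀ n : ℕ, n * ε ^ (n - 1) ≤ K * √ε ^ n := by
  have hρ0 : 0 < √ε := Real.sqrt_pos.2 hε
  have hρ1 : √ε < 1 := by rw [Real.sqrt_lt' one_pos]; simpa using hε1
  obtain ⟨M, hM⟩ := (tendsto_self_mul_const_pow_of_lt_one hρ0.le hρ1).bddAbove_range
  have hM' : ∀ n : ℕ, n * √ε ^ n ≤ M := fun n => hM ⟨n, rfl⟩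
  have hM0 : 0 ≤ M := by simpa using hM' 0
  refine ⟨M / ε, by positivity, fun n => ?_⟩
  rcases n with _ | n
  · simp only [Nat.cast_zero, zero_mul, pow_zero, mul_one]; positivity
  · have h := hM' (n + 1)
    rw [Nat.add_sub_cancel, div_mul_eq_mul_div, le_div_iff₀ hε]
    have e1 : ((n + 1 : ℕ) : ℝ) * ε ^ n * ε = ((n + 1 : ℕ) : ℝ) * √ε ^ (n + 1) * √ε ^ (n + 1) := by
      rw [mul_assoc, mul_assoc, ← pow_succ, ← mul_pow, Real.mul_self_sqrt hε.le]
    rw [e1]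
    exact mul_le_mul_of_nonneg_right h (by positivity)

/-- The arithmetic core of `exists_nearLimit`: g is the geometric sum, d the divided difference, U
and T are the n-th powers of u and t, and r = √ε^n. -/
lemma nearLimit_of_bounds {A b Γ ι K₁ r d g U T : ℝ} (hA : 0 < A) (hA1 : A ≤ 1) (hb1 : |b| ≤ 1)
    (hK₁ : 0 ≤ K₁) (hr0 : 0 ≤ r) (hr1 : r ≤ 1) (hG0 : 0 < Γ) (hG : Γ ≤ ι)
    (hAG : A * Γ = 1 - b ^ 2 * Γ) (hgG : g = Γ * (1 - T)) (hd : |d| ≤ K₁ * r) (hU : |U| ≤ r)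
    (hT : |T| ≤ r) :
    NearLimit A Γ ((3 * ι + K₁ + 1) * r) (1 - b ^ 2 * g) (A * g) g
      (g * (1 - U ^ 2) - A * d) (U * b * g) := by
  have hι : 0 ≤ ι := hG0.le.trans hG
  have hgΓ : |g - Γ| ≤ ι * r := by
    have : g - Γ = -(Γ * T) := by rw [hgG]; ring
    rw [this, abs_neg, abs_mul, abs_of_pos hG0]
    exact mul_le_mul hG hT (abs_nonneg _) hι
  have hιr : 0 ≤ ι * r := mul_nonneg hι hr0
  have hKr : 0 ≤ K₁ * r := mul_nonneg hK₁ hr0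
  have hgι : |g| ≤ 2 * ι := by
    have : |g| ≤ |g - Γ| + |Γ| := by simpa using abs_add_le (g - Γ) Γ
    rw [abs_of_pos hG0] at this
    have := mul_le_of_le_one_right hι hr1
    linarith
  have hK : (3 * ι + K₁ + 1) * r = 3 * (ι * r) + K₁ * r + r := by ring
  rw [hK]
  have shrink : ∀ {x y : ℝ}, |x| ≤ 1 → |x * y| ≤ |y| := fun {x y} hx => by
    rw [abs_mul]; exact mul_le_of_le_one_left (abs_nonneg _) hx
  have hA' : |A| ≤ 1 := by rwa [abs_of_pos hA]
  have hb2 : |b ^ 2| ≤ 1 := by rw [abs_pow]; exact pow_le_one₀ (abs_nonneg _) hb1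
  refine ⟨?_, ?_, ?_, ?_, ?_⟩
  · have : 1 - b ^ 2 * g - A * Γ = -(b ^ 2 * (g - Γ)) := by rw [hAG]; ring
    rw [this, abs_neg]
    linarith [shrink (y := g - Γ) hb2]
  · rw [← mul_sub]
    linarith [shrink (y := g - Γ) hA']
  · linarith
  · have e : g * (1 - U ^ 2) - A * d - Γ = (g - Γ) - g * U ^ 2 - A * d := by ring
    have h2 : |g * U ^ 2| ≤ 2 * ι * r := by
      rw [abs_mul, abs_pow]
      have hU2 : |U| ^ 2 ≤ r := by
        rw [sq]
        calc |U| * |U| ≤ r * 1 := mul_le_mul hU (hU.trans hr1) (abs_nonneg _) hr0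
          _ = r := mul_one r
      exact mul_le_mul hgι hU2 (by positivity) (by positivity)
    have h3 : |A * d| ≤ K₁ * r := (shrink hA').trans hd
    rw [e]
    have := abs_sub (g - Γ - g * U ^ 2) (A * d)
    have := abs_sub (g - Γ) (g * U ^ 2)
    linarith
  · have h1 : |U| * |b| ≤ r * 1 := mul_le_mul hU hb1 (abs_nonneg _) hr0
    have h2 : |U| * |b| * |g| ≤ r * 1 * (2 * ι) :=
      mul_le_mul h1 hgι (abs_nonneg _) (by positivity)
    rw [abs_mul, abs_mul]
    linarith

/-- Convergence of the Gram matrix, uniform in the parameters. -/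
theorem exists_nearLimit {ε a₀ : ℝ} (hε : 0 < ε) (hε1 : ε < 1) (ha₀ : 0 < a₀) :
    ∃ K : ℝ, 1 ≤ K ∧ ∀ p b f A : ℝ, p ^ 2 + b ^ 2 = 1 → A = 1 - f ^ 2 * p ^ 2 → a₀ ≤ A →
      |-f * p ^ 2| ≤ ε → |f ^ 2 * p ^ 2 - b ^ 2| ≤ ε → ∀ n : ℕ,
      NearLimit A (1 / (A + b ^ 2)) (K * √ε ^ n)
        (1 - b ^ 2 * geomSum (f ^ 2 * p ^ 2 - b ^ 2) n)
        (A * geomSum (f ^ 2 * p ^ 2 - b ^ 2) n) (geomSum (f ^ 2 * p ^ 2 - b ^ 2) n)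
        (geomSum (f ^ 2 * p ^ 2 - b ^ 2) n * (1 - ((-f * p ^ 2) ^ n) ^ 2) -
          A * powDiff ((-f * p ^ 2) ^ 2) (f ^ 2 * p ^ 2 - b ^ 2) n)
        ((-f * p ^ 2) ^ n * b * geomSum (f ^ 2 * p ^ 2 - b ^ 2) n) := by
  obtain ⟨K₁, hK₁, hK⟩ := exists_mul_pow_le_sqrt_pow hε hε1
  have hρ0 : 0 < √ε := Real.sqrt_pos.2 hε
  have hρ1 : √ε < 1 := by rw [Real.sqrt_lt' one_pos]; simpa using hε1
  have hερ : ε ≤ √ε := by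
    calc ε = √ε * √ε := (Real.mul_self_sqrt hε.le).symm
      _ ≤ √ε * 1 := by gcongr
      _ = √ε := mul_one _
  refine ⟨3 / a₀ + K₁ + 1, by have : 0 < 3 / a₀ := by positivity
                              linarith, ?_⟩
  intro p b f A hpb hA haA hu ht n
  have hA1 : A ≤ 1 := by rw [hA]; nlinarith [sq_nonneg (f * p)]
  have hb2 : b ^ 2 ≤ 1 := by nlinarith [sq_nonneg p]
  have hb1 : |b| ≤ 1 := by rwa [← sq_le_one_iff_abs_le_one]
  have hu2 : |(-f * p ^ 2) ^ 2| ≤ ε := by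
    rw [abs_pow]
    nlinarith [abs_nonneg (-f * p ^ 2)]
  have hd := (abs_powDiff_le hε.le hu2 ht n).trans (hK n)
  have hg := geomSum_mul (f ^ 2 * p ^ 2 - b ^ 2) n
  have hAb : 0 < A + b ^ 2 := by have := sq_nonneg b; linarith
  -- The geometric series thus sums to 1 / (A + b²), the limit Γ.
  have h1t : 1 - (f ^ 2 * p ^ 2 - b ^ 2) = A + b ^ 2 := by rw [hA]; ring
  rw [h1t] at hg
  have hpow : ∀ x : ℝ, |x| ≤ ε → |x ^ n| ≤ √ε ^ n := fun x hx => by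
    rw [abs_pow]; exact pow_le_pow_left₀ (abs_nonneg _) (hx.trans hερ) n
  have hU := hpow _ hu
  have hT := hpow _ ht
  have hr1 : √ε ^ n ≤ 1 := pow_le_one₀ hρ0.le hρ1.le
  have hr0 : 0 ≤ √ε ^ n := by positivity
  generalize √ε ^ n = r at *
  generalize hd' : powDiff ((-f * p ^ 2) ^ 2) (f ^ 2 * p ^ 2 - b ^ 2) n = d at *
  generalize hg' : geomSum (f ^ 2 * p ^ 2 - b ^ 2) n = g at *
  generalize (-f * p ^ 2) ^ n = U at *
  generalize (f ^ 2 * p ^ 2 - b ^ 2) ^ n = T at *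
  have hG : 1 / (A + b ^ 2) ≤ 1 / a₀ := 
    one_div_le_one_div_of_le ha₀ (by have := sq_nonneg b; linarith)
  have hG0 : 0 < 1 / (A + b ^ 2) := by positivity
  have hgG : g = 1 / (A + b ^ 2) * (1 - T) := by field_simp; linarith
  have hAG : A * (1 / (A + b ^ 2)) = 1 - b ^ 2 * (1 / (A + b ^ 2)) := by field_simp; ring
  have hA3 : 3 / a₀ = 3 * (1 / a₀) := by ring
  generalize 1 / (A + b ^ 2) = Γ at *
  rw [hA3]
  have ha0' : 0 < 1 / a₀ := by positivity
  generalize 1 / a₀ = ι at *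
  exact nearLimit_of_bounds (ha₀.trans_le haA) hA1 hb1 hK₁ hr0 hr1 hG0 hG hAG hgG hd hU hT

/-! ### Overlaps with the basis and their behaviour under cutting the chain. -/

/-- Coefficients, indexed by the last spin, of a vector on `n + 1` sites with respect to the
matrix product basis of the first `n` sites. -/
structure Coeff where
  x : Spin → ℂ
  y : Spin → ℂ
  z : Spin → ℂ
  w : Spin → ℂ

/-- All coefficients are bounded by `M`. -/
structure Coeff.Bdd (c : Coeff) (M : ℝ) : Prop where
  hx : ∀ i, ‖c.x i‖ ≤ M
  hy : ∀ i, ‖c.y i‖ ≤ M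
  hz : ∀ i, ‖c.z i‖ ≤ M
  hw : ∀ i, ‖c.w i‖ ≤ M

/-- The inner products of the vector with coefficients `c` and the matrix product basis of
`n + 1` sites, in terms of the Gram data of `n` sites and `U = (-f p²)ⁿ`. -/
noncomputable def overlap (p b f : ℝ) (a : ℂ) (α β γ ξ ω U : ℝ) (c : Coeff) : Fin 4 → ℂ :=
  ![p * (α * c.x 0 + ω * c.w 0) + b * β * c.y (-1),
    -f * p * β * c.y 0 + starRingEnd ℂ a * (α * c.x 1 + ω * c.w 1),
    p * γ * c.z 0 + U * (α * c.x (-1) + ω * c.w (-1)) + b * (ω * c.x (-1) + ξ * c.w (-1)),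
    -f * p * (ω * c.x 0 + ξ * c.w 0) - f * p * b * U * (α * c.x 0 + ω * c.w 0) +
      starRingEnd ℂ a * γ * c.z 1 - U * (-f * p ^ 2) * β * c.y (-1)]

/-- The limit of `overlap` in a long chain. -/
noncomputable def overlapLimit (p b f : ℝ) (a : ℂ) (A Γ : ℝ) (c : Coeff) : Fin 4 → ℂ :=
  ![A * Γ * (p * c.x 0 + b * c.y (-1)),
    A * Γ * (-f * p * c.y 0 + starRingEnd ℂ a * c.x 1),
    Γ * (p * c.z 0 + b * c.w (-1)),
    Γ * (-f * p * c.w 0 + starRingEnd ℂ a * c.z 1)]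

/-- The coefficients on the right part of a chain of `N = l + m` sites that go with the four basis
vectors of the left part; `Ul, Um, UN` are the powers of `-f p²`. -/
noncomputable def restrictCoeff (b : ℝ) (Ul Um UN : ℝ) (c : Coeff) : Fin 4 → Coeff :=
  ![⟨c.x, c.y, fun i => Ul * c.z i, fun i => Ul * c.w i⟩,
    ⟨fun i => Um * c.y i, 0, fun i => b * c.x i - UN * c.w i, fun i => b * c.y i⟩,
    ⟨c.z, c.w, 0, 0⟩,
    ⟨fun i => Um * c.w i, 0, fun i => b * c.z i, fun i => b * c.w i⟩]

lemma norm_mul_mul_le {s r x : ℂ} {η M : ℝ} (hs : ‖s‖ ≤ 1) (hr : ‖r‖ ≤ η) (hx : ‖x‖ ≤ M) :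
    ‖s * r * x‖ ≤ η * M := by
  have hη : 0 ≤ η := (norm_nonneg _).trans hr
  rw [norm_mul, norm_mul]
  calc ‖s‖ * ‖r‖ * ‖x‖ ≤ 1 * η * M :=
        mul_le_mul (mul_le_mul hs hr (norm_nonneg _) zero_le_one) hx (norm_nonneg _) (by linarith)
    _ = η * M := by ring

section estimates
variable {p b f A Γ η : ℝ} {a : ℂ}

/-- Each term of the difference carries a factor of size η (a Gram deviation or ω) or Cη (U times a
Gram entry); there are at most six terms. -/
theorem norm_overlap_sub_limit_le {α β γ ξ ω U M C : ℝ} {c : Coeff} (hp : |p| ≤ 1) (hb : |b| ≤ 1)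
    (hf : |f| ≤ 1) (ha : ‖a‖ ≤ 1) (hG : NearLimit A Γ η α β γ ξ ω) (hU : |U| ≤ η)
    (hC : 1 ≤ C) (hα : |α| ≤ C) (hβ : |β| ≤ C) (hη : η ≤ C) (hc : c.Bdd M) (j : Fin 4) :
    ‖overlap p b f a α β γ ξ ω U c j - overlapLimit p b f a A Γ c j‖ ≤ 6 * C * η * M := by
  obtain ⟨hα', hβ', hγ', hξ', hω'⟩ := hG
  have hM : 0 ≤ M := (norm_nonneg _).trans (hc.hx 0)
  have hη0 : 0 ≤ η := (abs_nonneg _).trans hα'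
  have hηM : 0 ≤ η * M := mul_nonneg hη0 hM
  have hCηM : η * M ≤ C * η * M := by nlinarith
  have nr : ∀ {x y : ℝ}, |x| ≤ y → ‖(x : ℂ)‖ ≤ y := fun h => by rwa [Complex.norm_real]
  have np := nr hp
  have nb := nr hb
  have nf := nr hf
  have na : ‖starRingEnd ℂ a‖ ≤ 1 := by rwa [RCLike.norm_conj]
  have nfp : ‖-(f : ℂ) * p‖ ≤ 1 := by
    rw [norm_mul, norm_neg]; exact mul_le_one₀ nf (norm_nonneg _) np
  have nfpb : ‖-(f : ℂ) * p * b‖ ≤ 1 := by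
    rw [norm_mul]; exact mul_le_one₀ nfp (norm_nonneg _) nb
  have nfpp : ‖(f : ℂ) * p * p‖ ≤ 1 := by
    rw [norm_mul]; refine mul_le_one₀ ?_ (norm_nonneg _) np
    simpa using nfp
  have nUα : ‖((U * α : ℝ) : ℂ)‖ ≤ C * η := nr (by
    rw [abs_mul]; nlinarith [abs_nonneg U, abs_nonneg α])
  have nUβ : ‖((U * β : ℝ) : ℂ)‖ ≤ C * η := nr (by
    rw [abs_mul]; nlinarith [abs_nonneg U, abs_nonneg β])
  have nUω : ‖((U * ω : ℝ) : ℂ)‖ ≤ C * η := nr (by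
    rw [abs_mul]; nlinarith [abs_nonneg U, abs_nonneg ω])
  have one : ‖(1 : ℂ)‖ ≤ 1 := by simp
  fin_cases j
  · have e : overlap p b f a α β γ ξ ω U c 0 - overlapLimit p b f a A Γ c 0 =
        p * ((α - A * Γ : ℝ) : ℂ) * c.x 0 + p * (ω : ℂ) * c.w 0 +
          b * ((β - A * Γ : ℝ) : ℂ) * c.y (-1) := by
      simp [overlap, overlapLimit]; ring
    refine (congrArg norm e).trans_le (norm_add₃_le.trans ?_)
    have h1 := norm_mul_mul_le np (nr hα') (hc.hx 0)
    have h2 := norm_mul_mul_le np (nr hω') (hc.hw 0)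
    have h3 := norm_mul_mul_le nb (nr hβ') (hc.hy (-1))
    linarith
  · have e : overlap p b f a α β γ ξ ω U c 1 - overlapLimit p b f a A Γ c 1 =
        -f * p * ((β - A * Γ : ℝ) : ℂ) * c.y 0 + starRingEnd ℂ a * ((α - A * Γ : ℝ) : ℂ) * c.x 1 +
          starRingEnd ℂ a * (ω : ℂ) * c.w 1 := by
      simp [overlap, overlapLimit]; ring
    refine (congrArg norm e).trans_le (norm_add₃_le.trans ?_)
    have h1 := norm_mul_mul_le nfp (nr hβ') (hc.hy 0)
    have h2 := norm_mul_mul_le na (nr hα') (hc.hx 1)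
    have h3 := norm_mul_mul_le na (nr hω') (hc.hw 1)
    linarith
  · have e : overlap p b f a α β γ ξ ω U c 2 - overlapLimit p b f a A Γ c 2 =
        p * ((γ - Γ : ℝ) : ℂ) * c.z 0 + (1 * ((U * α : ℝ) : ℂ) * c.x (-1) +
          1 * ((U * ω : ℝ) : ℂ) * c.w (-1)) + (b * (ω : ℂ) * c.x (-1) +
          b * ((ξ - Γ : ℝ) : ℂ) * c.w (-1)) := by
      simp [overlap, overlapLimit]; ring
    refine (congrArg norm e).trans_le (norm_add₃_le.trans ?_)
    have h1 := norm_mul_mul_le np (nr hγ') (hc.hz 0)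
    have h2 := norm_mul_mul_le one nUα (hc.hx (-1))
    have h3 := norm_mul_mul_le one nUω (hc.hw (-1))
    have h4 := norm_mul_mul_le nb (nr hω') (hc.hx (-1))
    have h5 := norm_mul_mul_le nb (nr hξ') (hc.hw (-1))
    have h6 := norm_add_le (1 * ((U * α : ℝ) : ℂ) * c.x (-1)) (1 * ((U * ω : ℝ) : ℂ) * c.w (-1))
    have h7 := norm_add_le (b * (ω : ℂ) * c.x (-1)) (b * ((ξ - Γ : ℝ) : ℂ) * c.w (-1))
    linarith
  · have e : overlap p b f a α β γ ξ ω U c 3 - overlapLimit p b f a A Γ c 3 =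
        (-f * p * (ω : ℂ) * c.x 0 + -f * p * ((ξ - Γ : ℝ) : ℂ) * c.w 0) +
          (-f * p * b * ((U * α : ℝ) : ℂ) * c.x 0 + -f * p * b * ((U * ω : ℝ) : ℂ) * c.w 0) +
          (starRingEnd ℂ a * ((γ - Γ : ℝ) : ℂ) * c.z 1 +
            f * p * p * ((U * β : ℝ) : ℂ) * c.y (-1)) := by
      simp [overlap, overlapLimit]; ring
    refine (congrArg norm e).trans_le (norm_add₃_le.trans ?_)
    have h1 := norm_mul_mul_le nfp (nr hω') (hc.hx 0)
    have h2 := norm_mul_mul_le nfp (nr hξ') (hc.hw 0)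
    have h3 := norm_mul_mul_le nfpb nUα (hc.hx 0)
    have h4 := norm_mul_mul_le nfpb nUω (hc.hw 0)
    have h5 := norm_mul_mul_le na (nr hγ') (hc.hz 1)
    have h6 := norm_mul_mul_le nfpp nUβ (hc.hy (-1))
    have h7 := norm_add_le (-f * p * (ω : ℂ) * c.x 0) (-f * p * ((ξ - Γ : ℝ) : ℂ) * c.w 0)
    have h8 := norm_add_le (-f * p * b * ((U * α : ℝ) : ℂ) * c.x 0)
      (-f * p * b * ((U * ω : ℝ) : ℂ) * c.w 0)
    have h9 := norm_add_le (starRingEnd ℂ a * ((γ - Γ : ℝ) : ℂ) * c.z 1)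
      (f * p * p * ((U * β : ℝ) : ℂ) * c.y (-1))
    linarith

/-- The factor 2 is needed only for the two-term entry b x - U_N w. -/
lemma restrictCoeff_bdd {Ul Um UN M : ℝ} {c : Coeff} (hb : |b| ≤ 1) (hl : |Ul| ≤ 1)
    (hm : |Um| ≤ 1) (hN : |UN| ≤ 1) (hc : c.Bdd M) (q : Fin 4) :
    (restrictCoeff b Ul Um UN c q).Bdd (2 * M) := by
  have hM : 0 ≤ M := (norm_nonneg _).trans (hc.hx 0)
  have key : ∀ {r : ℝ} {x : ℂ}, |r| ≤ 1 → ‖x‖ ≤ M → ‖(r : ℂ) * x‖ ≤ M := fun {r x} hr hx => by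
    rw [norm_mul, Complex.norm_real]
    calc |r| * ‖x‖ ≤ 1 * M := mul_le_mul hr hx (norm_nonneg _) zero_le_one
      _ = M := one_mul M
  have two : ∀ {x : ℂ}, ‖x‖ ≤ M → ‖x‖ ≤ 2 * M := fun h => by linarith
  fin_cases q
  · exact ⟨fun i => two (hc.hx i), fun i => two (hc.hy i), fun i => two (key hl (hc.hz i)),
      fun i => two (key hl (hc.hw i))⟩
  · refine ⟨fun i => two (key hm (hc.hy i)), fun i => ?_, fun i => ?_,
      fun i => two (key hb (hc.hy i))⟩
    · change ‖(0 : ℂ)‖ ≤ _; rw [norm_zero]; linarith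
    · have := norm_sub_le ((b : ℂ) * c.x i) (UN * c.w i)
      have h1 := key hb (hc.hx i)
      have h2 := key hN (hc.hw i)
      change ‖(b : ℂ) * c.x i - UN * c.w i‖ ≤ _
      linarith
  · refine ⟨fun i => two (hc.hz i), fun i => two (hc.hw i), fun i => ?_, fun i => ?_⟩ <;>
    · change ‖(0 : ℂ)‖ ≤ _; rw [norm_zero]; linarith
  · refine ⟨fun i => two (key hm (hc.hw i)), fun i => ?_, fun i => two (key hb (hc.hz i)),
      fun i => two (key hb (hc.hw i))⟩
    change ‖(0 : ℂ)‖ ≤ _; rw [norm_zero]; linarith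

/-- If the limit overlaps of `c` are small, so are those of the restrictions of `c`. -/
theorem norm_overlapLimit_restrictCoeff_le {Ul Um UN M D ι : ℝ} {c : Coeff} (hp : |p| ≤ 1)
    (hb : |b| ≤ 1) (ha : ‖a‖ ≤ 1) (hl : |Ul| ≤ 1) (hm : |Um| ≤ η) (hN : |UN| ≤ η)
    (hA : 0 < A) (hA1 : A ≤ 1) (hAι : 1 / A ≤ ι) (hΓ : 0 ≤ Γ) (hΓι : Γ ≤ ι)
    (hc : c.Bdd M) (hD : ∀ j, ‖overlapLimit p b f a A Γ c j‖ ≤ D) (q j : Fin 4) :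
    ‖overlapLimit p b f a A Γ (restrictCoeff b Ul Um UN c q) j‖ ≤ ι * (D + η * M) := by
  have hM : 0 ≤ M := (norm_nonneg _).trans (hc.hx 0)
  have hη0 : 0 ≤ η := (abs_nonneg _).trans hm
  have hD0 : 0 ≤ D := (norm_nonneg _).trans (hD 0)
  have hηM : 0 ≤ η * M := mul_nonneg hη0 hM
  have hι1 : 1 ≤ ι := le_trans (by rw [le_div_iff₀ hA]; linarith) hAι
  have nr : ∀ {x y : ℝ}, |x| ≤ y → ‖(x : ℂ)‖ ≤ y := fun h => by rwa [Complex.norm_real]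
  have na : ‖starRingEnd ℂ a‖ ≤ 1 := by rwa [RCLike.norm_conj]
  have np := nr hp
  have nb := nr hb
  have nA : ‖(A : ℂ)‖ ≤ 1 := nr (by rwa [abs_of_pos hA])
  have nl := nr hl
  have hιD : D ≤ ι * (D + η * M) := by nlinarith
  have hz0 : 0 ≤ ι * (D + η * M) := by positivity
  have h0 := hD 0
  have h1 := hD 1
  have h2 := hD 2
  have h3 := hD 3
  -- The sixteen entries are of three kinds: a bounded multiple of a limit overlap of `c` (`scale`),
  -- a term with a factor Um (`small`), or b/A times a limit overlap plus a term with a factor UN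
  -- (`mix`). The last kind, which turns the weight AΓ into Γ, is why 1/A must be bounded.
  have scale : ∀ {r X Y : ℂ}, ‖r‖ ≤ 1 → ‖X‖ ≤ D → Y = r * X → ‖Y‖ ≤ ι * (D + η * M) :=
    fun {r X Y} hr hX hY => by
      rw [hY, norm_mul]
      refine le_trans ?_ hιD
      calc ‖r‖ * ‖X‖ ≤ 1 * D := mul_le_mul hr hX (norm_nonneg _) zero_le_one
        _ = D := one_mul D
  have small : ∀ {s r x Y : ℂ}, ‖s‖ ≤ 1 → ‖r‖ ≤ η → ‖x‖ ≤ M → Y = Γ * (s * r * x) →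
      ‖Y‖ ≤ ι * (D + η * M) := fun {s r x Y} hs hr hx hY => by
    rw [hY, norm_mul]
    have := norm_mul_mul_le hs hr hx
    calc ‖(Γ : ℂ)‖ * ‖s * r * x‖ ≤ ι * (η * M) :=
          mul_le_mul (nr (by rwa [abs_of_nonneg hΓ])) this (norm_nonneg _) (by linarith)
      _ ≤ _ := by nlinarith
  have mix : ∀ {s t r x X Y : ℂ}, ‖t‖ ≤ 1 → ‖s‖ ≤ 1 → ‖r‖ ≤ η → ‖x‖ ≤ M → ‖X‖ ≤ D →
      A * Y = t * X - A * (Γ * (s * r * x)) → ‖Y‖ ≤ ι * (D + η * M) :=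
    fun {s t r x X Y} ht hs hr hx hX hY => by
      have hA' : (A : ℂ) ≠ 0 := by exact_mod_cast hA.ne'
      have hY' : Y = ((1 / A : ℝ) : ℂ) * (t * X) - Γ * (s * r * x) := by
        push_cast; field_simp; linear_combination hY
      rw [hY']
      refine (norm_sub_le _ _).trans ?_
      rw [norm_mul, norm_mul, norm_mul (Γ : ℂ)]
      have e1 : ‖t‖ * ‖X‖ ≤ D := by
        calc ‖t‖ * ‖X‖ ≤ 1 * D := mul_le_mul ht hX (norm_nonneg _) zero_le_one
          _ = D := one_mul D
      have e2 : ‖((1 / A : ℝ) : ℂ)‖ * (‖t‖ * ‖X‖) ≤ ι * D :=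
        mul_le_mul (nr (by rwa [abs_of_pos (by positivity)])) e1 (by positivity) (by linarith)
      have e3 : ‖(Γ : ℂ)‖ * ‖s * r * x‖ ≤ ι * (η * M) :=
        mul_le_mul (nr (by rwa [abs_of_nonneg hΓ])) (norm_mul_mul_le hs hr hx) (norm_nonneg _)
          (by linarith)
      linarith
  have nAp : ‖(A : ℂ) * p‖ ≤ 1 := by rw [norm_mul]; exact mul_le_one₀ nA (norm_nonneg _) np
  have nAa : ‖(A : ℂ) * starRingEnd ℂ a‖ ≤ 1 := by
    rw [norm_mul]; exact mul_le_one₀ nA (norm_nonneg _) na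
  have one : ‖(1 : ℂ)‖ ≤ 1 := by simp
  fin_cases q <;> fin_cases j
  · exact scale one h0 (by simp [overlapLimit, restrictCoeff])
  · exact scale one h1 (by simp [overlapLimit, restrictCoeff])
  · exact scale nl h2 (by simp [overlapLimit, restrictCoeff]; ring)
  · exact scale nl h3 (by simp [overlapLimit, restrictCoeff]; ring)
  · exact small nAp (nr hm) (hc.hy 0) (by simp [overlapLimit, restrictCoeff]; ring)
  · exact small nAa (nr hm) (hc.hy 1) (by simp [overlapLimit, restrictCoeff]; ring)
  · exact mix nb np (nr hN) (hc.hw 0) h0 (by simp [overlapLimit, restrictCoeff]; ring)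
  · exact mix nb na (nr hN) (hc.hw 1) h1 (by simp [overlapLimit, restrictCoeff]; ring)
  · exact scale nA h2 (by simp [overlapLimit, restrictCoeff]; ring)
  · exact scale nA h3 (by simp [overlapLimit, restrictCoeff]; ring)
  · simpa [overlapLimit, restrictCoeff] using hz0
  · simpa [overlapLimit, restrictCoeff] using hz0
  · exact small nAp (nr hm) (hc.hw 0) (by simp [overlapLimit, restrictCoeff]; ring)
  · exact small nAa (nr hm) (hc.hw 1) (by simp [overlapLimit, restrictCoeff]; ring)
  · exact scale nb h2 (by simp [overlapLimit, restrictCoeff]; ring)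
  · exact scale nb h3 (by simp [overlapLimit, restrictCoeff]; ring)

end estimates

/-- The norm square of an amplitude function. -/
noncomputable def ampSq {n : ℕ} (ψ : (Fin n → Spin) → ℂ) : ℝ := ∑ τ, ‖ψ τ‖ ^ 2

lemma ampSq_nonneg {n : ℕ} (ψ : (Fin n → Spin) → ℂ) : 0 ≤ ampSq ψ :=
  Finset.sum_nonneg fun _ _ => sq_nonneg _

lemma norm_ampInner_le {n : ℕ} (ψ φ : (Fin n → Spin) → ℂ) :
    ‖ampInner ψ φ‖ ≤ √(ampSq ψ) * √(ampSq φ) := by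
  have h := norm_inner_le_norm (𝕜 := ℂ) (WithLp.toLp 2 ψ : EuclideanSpace ℂ (Fin n → Spin))
    (WithLp.toLp 2 φ)
  rw [EuclideanSpace.norm_eq, EuclideanSpace.norm_eq, PiLp.inner_apply] at h
  simpa [ampInner, ampSq, mul_comm] using h

/-- The slice with last spin `i` of the vector with coefficients `c`. -/
noncomputable def Coeff.slice {n : ℕ} (c : Coeff) (v : Fin 4 → (Fin n → Spin) → ℂ) (i : Spin) :
    (Fin n → Spin) → ℂ :=
  c.x i • v 0 + c.y i • v 1 + c.z i • v 2 + c.w i • v 3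

lemma ampInner_mps_succ {p b f : ℝ} {a : ℂ} {n : ℕ} {α β γ ξ ω : ℝ}
    (hG : IsGram (mps p b f a n) α β γ ξ ω) {ψ : (Fin (n + 1) → Spin) → ℂ} {c : Coeff}
    (hψ : ∀ i, (fun τ => ψ (Fin.snoc τ i)) = c.slice (mps p b f a n) i) (j : Fin 4) :
    ampInner (mps p b f a (n + 1) j) ψ =
      overlap p b f a α β γ ξ ω ((-f * p ^ 2) ^ n) c j := by
  obtain ⟨h00, h11, h22, h33, h03, h30, h01, h10, h02, h20, h12, h21, h13, h31, h23, h32⟩ := hG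
  have e : ∀ r : ℝ, starRingEnd ℂ (r : ℂ) = r := Complex.conj_ofReal
  revert j
  rw [Fin.forall_fin_succ, Fin.forall_fin_succ, Fin.forall_fin_succ, Fin.forall_fin_one]
  refine ⟨?_, ?_, ?_, ?_⟩
  · change ampInner (mps p b f a (n + 1) 0) ψ = _
    simp only [mps_succ_zero, ampInner_joinLast, hψ, Coeff.slice, ampInner_add_right,
      ampInner_smul_left, ampInner_smul_right, ampInner_zero_left, e, h00, h11, h03, h01, h10, h02,
      h12, h13, overlap, Matrix.cons_val]
    ring
  · change ampInner (mps p b f a (n + 1) 1) ψ = overlap _ _ _ _ _ _ _ _ _ _ _ 1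
    simp only [mps_succ_one, ampInner_joinLast, hψ, Coeff.slice, ampInner_add_right,
      ampInner_smul_left, ampInner_smul_right, ampInner_zero_left, e, h00, h11, h03, h01, h10, h02,
      h12, h13, overlap, Matrix.cons_val, map_mul, map_neg]
    ring
  · change ampInner (mps p b f a (n + 1) 2) ψ = overlap _ _ _ _ _ _ _ _ _ _ _ 2
    simp only [mps_succ_two, ampInner_joinLast, hψ, Coeff.slice, ampInner_add_right,
      ampInner_add_left, ampInner_smul_left, ampInner_smul_right, ampInner_zero_left, e, h00, h22,
      h33, h03, h30, h01, h02, h20, h21, h31, h23, h32, overlap, Matrix.cons_val, map_mul, map_neg,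
      map_pow, Complex.ofReal_pow, Complex.ofReal_mul, Complex.ofReal_neg]
    ring
  · change ampInner (mps p b f a (n + 1) 3) ψ = overlap _ _ _ _ _ _ _ _ _ _ _ 3
    simp only [mps_succ_three, ampInner_joinLast, hψ, Coeff.slice, ampInner_add_right,
      ampInner_add_left, ampInner_smul_left, ampInner_smul_right, e, h00, h11, h22,
      h33, h03, h30, h01, h10, h12, h13, h02, h20, h21, h31, h23, h32, overlap, Matrix.cons_val,
      map_mul, map_neg, map_pow, Complex.ofReal_pow, Complex.ofReal_mul, Complex.ofReal_neg]
    ring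

/-- Diagonal dominance: the only off-diagonal entry ω couples the first and the last vector. It
bounds coefficients by the norm of the vector. -/
lemma IsGram.le_ampSq {n : ℕ} {v : Fin 4 → (Fin n → Spin) → ℂ} {α β γ ξ ω κ : ℝ}
    (hG : IsGram v α β γ ξ ω) (hα : κ + |ω| ≤ α) (hβ : κ ≤ β) (hγ : κ ≤ γ) (hξ : κ + |ω| ≤ ξ)
    (x y z w : ℂ) :
    κ * (‖x‖ ^ 2 + ‖y‖ ^ 2 + ‖z‖ ^ 2 + ‖w‖ ^ 2) ≤
      ampSq (x • v 0 + y • v 1 + z • v 2 + w • v 3) := by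
  obtain ⟨h00, h11, h22, h33, h03, h30, h01, h10, h02, h20, h12, h21, h13, h31, h23, h32⟩ := hG
  have h := ampInner_self (x • v 0 + y • v 1 + z • v 2 + w • v 3)
  simp only [ampInner_add_left, ampInner_add_right,
      ampInner_smul_left, ampInner_smul_right,
      h00, h11, h22, h33, h03, h30, h01, h10, h02, h20, h12, h21, h13, h31, h23, h32] at h
  have h' := congrArg Complex.re h
  rw [Complex.ofReal_re] at h'
  rw [ampSq, ← h']
  have e : ∀ v : ℂ, ‖v‖ ^ 2 = v.re ^ 2 + v.im ^ 2 := fun v => by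
    rw [Complex.sq_norm, Complex.normSq_apply]; ring
  simp only [e, Complex.add_re, Complex.add_im, Complex.mul_re, Complex.mul_im, Complex.conj_re, Complex.conj_im,
    Complex.ofReal_re, Complex.ofReal_im, Complex.zero_re, Complex.zero_im]
  have cross : ∀ s t : ℝ, -(|ω| * (s ^ 2 + t ^ 2)) ≤ 2 * (ω * (s * t)) := fun s t => by
    have h1 : |2 * (ω * (s * t))| ≤ |ω| * (s ^ 2 + t ^ 2) := by
      rw [abs_mul, abs_mul, mul_left_comm]
      refine mul_le_mul_of_nonneg_left ?_ (abs_nonneg _)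
      rw [← abs_mul, abs_le]
      constructor <;> nlinarith [sq_nonneg (s - t), sq_nonneg (s + t)]
    linarith [(abs_le.1 h1).1]
  have c1 := cross x.re w.re
  have c2 := cross x.im w.im
  have m : ∀ {s t : ℝ} (v : ℝ), s ≤ t → s * v ^ 2 ≤ t * v ^ 2 := fun v h =>
    mul_le_mul_of_nonneg_right h (sq_nonneg v)
  have a1 := m x.re hα
  have a2 := m x.im hα
  have a3 := m y.re hβ
  have a4 := m y.im hβ
  have a5 := m z.re hγ
  have a6 := m z.im hγ
  have a7 := m w.re hξ
  have a8 := m w.im hξ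
  linarith

lemma ampSq_snoc {n : ℕ} (ψ : (Fin (n + 1) → Spin) → ℂ) :
    ampSq ψ = ∑ i, ampSq (fun τ : Fin n → Spin => ψ (Fin.snoc τ i)) := sum_snoc _

/-- The amplitude of a joint vector, split into the left and the right part of the chain. -/
lemma append_eq_sum_restrictCoeff {p b f : ℝ} {a : ℂ} (hpb : p ^ 2 + b ^ 2 = 1) {l m : ℕ}
    {ψ : (Fin (l + m + 1) → Spin) → ℂ} {c : Coeff}
    (hψ : ∀ i, (fun τ => ψ (Fin.snoc τ i)) = c.slice (mps p b f a (l + m)) i)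
    (σ : Fin l → Spin) (τ : Fin (m + 1) → Spin) :
    ψ (Fin.append (m := l) (n := m + 1) σ τ) = ∑ q, mps p b f a l q σ *
      (restrictCoeff b ((-f * p ^ 2) ^ l) ((-f * p ^ 2) ^ m) ((-f * p ^ 2) ^ (l + m)) c q).slice
        (mps p b f a m) (τ (Fin.last m)) (Fin.init τ) := by
  rw [← Fin.snoc_init_self τ, Fin.append_snoc, Fin.snoc_last, Fin.init_snoc]
  have h := congrFun (hψ (τ (Fin.last m))) (Fin.append σ (Fin.init τ))
  obtain ⟨h0, h1, h2, h3⟩ := mps_append (f := f) (a := a) hpb l σ m (Fin.init τ)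
  refine h.trans ?_
  simp only [Coeff.slice, Pi.add_apply, Pi.smul_apply, smul_eq_mul, h0, h1, h2, h3,
    Fin.sum_univ_four, restrictCoeff, Matrix.cons_val, Pi.zero_apply, zero_mul, Complex.ofReal_pow,
    Complex.ofReal_mul, Complex.ofReal_neg]
  ring

lemma ampInner_eq_sum_sum {l m : ℕ} {φ ψ : (Fin (l + (m + 1)) → Spin) → ℂ}
    {θ χ : Fin 4 → (Fin l → Spin) → ℂ} {v R : Fin 4 → (Fin (m + 1) → Spin) → ℂ}
    (hφ : ∀ σ τ, φ (Fin.append σ τ) = ∑ j, θ j σ * v j τ)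
    (hψ : ∀ σ τ, ψ (Fin.append σ τ) = ∑ q, χ q σ * R q τ) :
    ampInner φ ψ = ∑ j, ∑ q, ampInner (θ j) (χ q) * ampInner (v j) (R q) := by
  simp only [ampInner]
  rw [sum_append]
  simp only [hφ, hψ, map_sum, map_mul, Finset.sum_mul_sum]
  rw [Finset.sum_congr rfl fun σ _ => Finset.sum_comm, Finset.sum_comm]
  refine Finset.sum_congr rfl fun j _ => ?_
  rw [Finset.sum_congr rfl fun σ _ => Finset.sum_comm, Finset.sum_comm]
  refine Finset.sum_congr rfl fun q _ => Finset.sum_congr rfl fun σ _ =>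
    Finset.sum_congr rfl fun τ _ => ?_
  ring

lemma le_sqrt_div {κ s t : ℝ} (hκ : 0 < κ) (h : κ * s ^ 2 ≤ t) :
    s ≤ √t / √κ := by
  rw [← Real.sqrt_div' _ hκ.le]
  apply Real.le_sqrt_of_sq_le
  rw [le_div_iff₀ hκ]
  linarith

lemma NearLimit.mono {A Γ η η' α β γ ξ ω : ℝ} (h : NearLimit A Γ η α β γ ξ ω) (hη : η ≤ η') :
    NearLimit A Γ η' α β γ ξ ω :=
  ⟨h.hα.trans hη, h.hβ.trans hη, h.hγ.trans hη, h.hξ.trans hη, h.hω.trans hη⟩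

/-- Vectors that are ground states on the first `l + m` sites and orthogonal to the ground states
of all `l + m + 1` sites are almost orthogonal to the vectors that are ground states on the last
`m + 1` sites. -/
theorem exists_norm_ampInner_le {ε a₀ : ℝ} (hε : 0 < ε) (hε1 : ε < 1) (ha₀ : 0 < a₀) :
    ∃ K₀ K : ℝ, 1 ≤ K₀ ∧ 0 ≤ K ∧ ∀ (p b f A : ℝ) (a : ℂ), p ^ 2 + b ^ 2 = 1 →
      A = 1 - f ^ 2 * p ^ 2 → starRingEnd ℂ a * a = A → a₀ ≤ A → |f| ≤ 1 →
      |-f * p ^ 2| ≤ ε → |f ^ 2 * p ^ 2 - b ^ 2| ≤ ε → ∀ l m : ℕ, K₀ * √ε ^ m ≤ a₀ / 8 →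
      ∀ (φ ψ : (Fin (l + m + 1) → Spin) → ℂ) (θ : Fin 4 → (Fin l → Spin) → ℂ) (c : Coeff),
      (∀ (σ : Fin l → Spin) (τ : Fin (m + 1) → Spin),
        φ (Fin.append (m := l) (n := m + 1) σ τ) = ∑ j, θ j σ * mps p b f a (m + 1) j τ) →
      (∀ i, (fun τ => ψ (Fin.snoc τ i)) = c.slice (mps p b f a (l + m)) i) →
      (∀ j, ampInner (mps p b f a (l + m + 1) j) ψ = 0) →
      ‖ampInner φ ψ‖ ≤ K * √ε ^ m * (√(ampSq φ) * √(ampSq ψ)) := by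
  obtain ⟨K₀, hK₀, hlim⟩ := exists_nearLimit hε hε1 ha₀
  have hρ0 : 0 < √ε := Real.sqrt_pos.2 hε
  have hρ1 : √ε ≤ 1 := Real.sqrt_le_one.2 hε1.le
  set ι : ℝ := 1 / a₀ with hι
  have hι0 : 0 < ι := by positivity
  -- Bounds all diagonal Gram entries: the limits AΓ ≤ 1 and Γ ≤ ι, plus a deviation of at most K₀.
  set C : ℝ := ι + K₀ + 1 with hC
  -- The limiting diagonal entries are at least a₀/2; a deviation and |ω| of at most a₀/8 each leave
  -- a₀/4.
  set κ : ℝ := a₀ / 4 with hκ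
  have hκ0 : 0 < κ := by positivity
  have hC0 : 1 ≤ C := by linarith
  -- The 16 counts the pairs of a right basis vector and a left basis vector; the two √κ come from
  -- bounding the coefficients of φ and of ψ.
  refine ⟨K₀, 16 * ((ι * (6 * C + 1) + 12 * C) * K₀ * √C / (√κ * √κ)), hK₀,
    by positivity, ?_⟩
  intro p b f A a hpb hA ha haA hf hu ht l m hm φ ψ θ c hφ hψ hperp
  have hA0 : 0 < A := ha₀.trans_le haA
  have hA1 : A ≤ 1 := by rw [hA]; nlinarith [sq_nonneg (f * p)]
  have hp : |p| ≤ 1 := by rw [← sq_le_one_iff_abs_le_one]; nlinarith [sq_nonneg b]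
  have hb2 : b ^ 2 ≤ 1 := by nlinarith [sq_nonneg p]
  have hb : |b| ≤ 1 := by rwa [← sq_le_one_iff_abs_le_one]
  have hna : ‖a‖ ≤ 1 := by
    have h1 : ‖a‖ ^ 2 = A := by
      have := Complex.conj_mul' a
      rw [ha] at this; exact_mod_cast this.symm
    rw [← sq_le_one_iff₀ (norm_nonneg _), h1]; exact hA1
  set Γ : ℝ := 1 / (A + b ^ 2) with hΓ
  have hAb : 0 < A + b ^ 2 := by have := sq_nonneg b; linarith
  have hΓ0 : 0 < Γ := by positivity
  have hΓι : Γ ≤ ι := one_div_le_one_div_of_le ha₀ (by have := sq_nonneg b; linarith)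
  have hΓ2 : 1 / 2 ≤ Γ := one_div_le_one_div_of_le hAb (by linarith)
  have hAΓ1 : A * Γ ≤ 1 := by
    rw [hΓ, mul_one_div, div_le_one hAb]; have := sq_nonneg b; linarith
  have hAΓ2 : a₀ / 2 ≤ A * Γ := by
    calc a₀ / 2 = a₀ * (1 / 2) := by ring
      _ ≤ A * Γ := mul_le_mul haA hΓ2 (by norm_num) hA0.le
  have hgram : ∀ n, ∃ α β γ ξ ω, IsGram (mps p b f a n) α β γ ξ ω ∧
      NearLimit A Γ (K₀ * √ε ^ n) α β γ ξ ω := fun n =>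
    ⟨_, _, _, _, _, mps_isGram (f := f) hpb hA ha n, hlim p b f A hpb hA haA hu ht n⟩
  have hmono : ∀ {n n' : ℕ}, n ≤ n' → K₀ * √ε ^ n' ≤ K₀ * √ε ^ n := fun h =>
    mul_le_mul_of_nonneg_left (pow_le_pow_of_le_one hρ0.le hρ1 h) (by linarith)
  have hK₀' : ∀ n, K₀ * √ε ^ n ≤ K₀ := fun n => by simpa using hmono (Nat.zero_le n)
  have hερ : ε ≤ √ε := by
    calc ε = √ε * √ε := (Real.mul_self_sqrt hε.le).symm
      _ ≤ √ε * 1 := by gcongr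
      _ = √ε := mul_one _
  have hU : ∀ n, |(-f * p ^ 2) ^ n| ≤ K₀ * √ε ^ n := fun n => by
    rw [abs_pow]
    calc |-f * p ^ 2| ^ n ≤ √ε ^ n := pow_le_pow_left₀ (abs_nonneg _) (hu.trans hερ) n
      _ ≤ K₀ * √ε ^ n := le_mul_of_one_le_left (by positivity) hK₀
  have hU1 : ∀ n, |(-f * p ^ 2) ^ n| ≤ 1 := fun n => by
    rw [abs_pow]; exact pow_le_one₀ (abs_nonneg _) (hu.trans hε1.le)
  set η : ℝ := K₀ * √ε ^ m with hη
  have hη0 : 0 ≤ η := by positivity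
  have hηC : η ≤ C := (hK₀' m).trans (by linarith)
  have hdiag : ∀ {n : ℕ} {α β γ ξ ω : ℝ}, NearLimit A Γ (K₀ * √ε ^ n) α β γ ξ ω →
      |α| ≤ C ∧ |β| ≤ C ∧ |γ| ≤ C ∧ |ξ| ≤ C := by
    intro n α β γ ξ ω h
    obtain ⟨h1, h2, h3, h4, -⟩ := h.mono (hK₀' n)
    rw [abs_le] at h1 h2 h3 h4
    refine ⟨?_, ?_, ?_, ?_⟩ <;> rw [abs_le] <;> constructor <;> linarith
  have hlow : ∀ {n : ℕ} {α β γ ξ ω : ℝ}, m ≤ n → NearLimit A Γ (K₀ * √ε ^ n) α β γ ξ ω →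
      κ + |ω| ≤ α ∧ κ ≤ β ∧ κ ≤ γ ∧ κ + |ω| ≤ ξ := by
    intro n α β γ ξ ω hn h
    obtain ⟨h1, h2, h3, h4, h5⟩ := h.mono ((hmono hn).trans hm)
    rw [abs_le] at h1 h2 h3 h4
    refine ⟨?_, ?_, ?_, ?_⟩ <;> linarith
  set M : ℝ := √(ampSq ψ) / √κ with hM
  have hM0 : 0 ≤ M := by positivity
  obtain ⟨α, β, γ, ξ, ω, hGN, hLN⟩ := hgram (l + m)
  have hmN : m ≤ l + m := Nat.le_add_left m l
  have hc : c.Bdd M := by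
    obtain ⟨l1, l2, l3, l4⟩ := hlow hmN hLN
    have key : ∀ i, κ * (‖c.x i‖ ^ 2 + ‖c.y i‖ ^ 2 + ‖c.z i‖ ^ 2 + ‖c.w i‖ ^ 2) ≤ ampSq ψ :=
      fun i => by
        refine (hGN.le_ampSq l1 l2 l3 l4 (c.x i) (c.y i) (c.z i) (c.w i)).trans ?_
        rw [ampSq_snoc]
        simp only [hψ]
        exact Finset.single_le_sum (f := fun i => ampSq (c.slice (mps p b f a (l + m)) i))
          (fun i _ => ampSq_nonneg _) (Finset.mem_univ i)
    have part : ∀ {s t : ℝ}, κ * t ≤ ampSq ψ → s ^ 2 ≤ t → s ≤ M := fun h1 h2 =>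
      le_sqrt_div hκ0 ((mul_le_mul_of_nonneg_left h2 hκ0.le).trans h1)
    refine ⟨fun i => part (key i) ?_, fun i => part (key i) ?_, fun i => part (key i) ?_,
      fun i => part (key i) ?_⟩ <;>
    · have := sq_nonneg ‖c.x i‖
      have := sq_nonneg ‖c.y i‖
      have := sq_nonneg ‖c.z i‖
      have := sq_nonneg ‖c.w i‖
      linarith
  -- The exact overlaps vanish by orthogonality, so each limit overlap equals its own approximation
  -- error up to sign.
  have hD : ∀ j, ‖overlapLimit p b f a A Γ c j‖ ≤ 6 * C * η * M := fun j => by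
    obtain ⟨b1, b2, -, -⟩ := hdiag hLN
    have h := norm_overlap_sub_limit_le hp hb hf hna (hLN.mono (hmono hmN))
      ((hU (l + m)).trans (hmono hmN)) hC0 b1 b2 hηC hc j
    rw [← ampInner_mps_succ hGN hψ j, hperp j, zero_sub, norm_neg] at h
    exact h
  set R : Fin 4 → Coeff :=
    restrictCoeff b ((-f * p ^ 2) ^ l) ((-f * p ^ 2) ^ m) ((-f * p ^ 2) ^ (l + m)) c with hR
  set Rv : Fin 4 → (Fin (m + 1) → Spin) → ℂ := fun q τ =>
    (R q).slice (mps p b f a m) (τ (Fin.last m)) (Fin.init τ) with hRv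
  -- From the exact overlap on the right block to its limit, and from there back to the small limit
  -- overlaps of `c`.
  have hRbound : ∀ j q, ‖ampInner (mps p b f a (m + 1) j) (Rv q)‖ ≤
      (ι * (6 * C + 1) + 12 * C) * η * M := fun j q => by
    obtain ⟨α', β', γ', ξ', ω', hGm, hLm⟩ := hgram m
    obtain ⟨b1, b2, -, -⟩ := hdiag hLm
    have h1 := norm_overlap_sub_limit_le hp hb hf hna hLm (hU m) hC0 b1 b2 hηC
      (restrictCoeff_bdd hb (hU1 l) (hU1 m) (hU1 (l + m)) hc q) j
    have h2 := norm_overlapLimit_restrictCoeff_le (A := A) (Γ := Γ) (ι := ι) (f := f) hp hb hna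
      (hU1 l) (hU m) ((hU (l + m)).trans (hmono hmN)) hA0 hA1
      (one_div_le_one_div_of_le ha₀ haA) hΓ0.le hΓι hc hD q j
    have h3 : ampInner (mps p b f a (m + 1) j) (Rv q) =
        overlap p b f a α' β' γ' ξ' ω' ((-f * p ^ 2) ^ m) (R q) j :=
      ampInner_mps_succ hGm (fun i => by
        funext τ
        simp only [hRv, Fin.snoc_last, Fin.init_snoc]) j
    rw [h3]
    have h4 := norm_le_norm_sub_add (overlap p b f a α' β' γ' ξ' ω' ((-f * p ^ 2) ^ m) (R q) j)
      (overlapLimit p b f a A Γ (R q) j)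
    calc _ ≤ _ := h4
      _ ≤ 6 * C * η * (2 * M) + ι * (6 * C * η * M + η * M) := add_le_add h1 h2
      _ = _ := by ring
  -- The Gram lower bound on the right block is applied for each fixed left configuration and then
  -- summed.
  have hθ : ∀ j, √(ampSq (θ j)) ≤ √(ampSq φ) / √κ := by
    obtain ⟨α', β', γ', ξ', ω', hGm, hLm⟩ := hgram (m + 1)
    obtain ⟨l1, l2, l3, l4⟩ := hlow (Nat.le_succ m) hLm
    have e : ampSq φ = ∑ σ : Fin l → Spin, ampSq (fun τ : Fin (m + 1) → Spin =>
        φ (Fin.append (m := l) (n := m + 1) σ τ)) :=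
      sum_append (l := l) (m := m + 1) (fun τ => ‖φ τ‖ ^ 2)
    have key : ∀ σ, κ * (‖θ 0 σ‖ ^ 2 + ‖θ 1 σ‖ ^ 2 + ‖θ 2 σ‖ ^ 2 + ‖θ 3 σ‖ ^ 2) ≤
        ampSq (fun τ : Fin (m + 1) → Spin => φ (Fin.append (m := l) (n := m + 1) σ τ)) :=
      fun σ => by
        refine (hGm.le_ampSq l1 l2 l3 l4 _ _ _ _).trans_eq (congrArg ampSq ?_)
        funext τ
        rw [hφ, Fin.sum_univ_four]
        rfl
    intro j
    refine le_sqrt_div hκ0 ?_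
    rw [Real.sq_sqrt (ampSq_nonneg _), e, ampSq, Finset.mul_sum]
    refine Finset.sum_le_sum fun σ _ => le_trans ?_ (key σ)
    refine mul_le_mul_of_nonneg_left ?_ hκ0.le
    have := sq_nonneg ‖θ 0 σ‖
    have := sq_nonneg ‖θ 1 σ‖
    have := sq_nonneg ‖θ 2 σ‖
    have := sq_nonneg ‖θ 3 σ‖
    fin_cases j <;> simp only [Fin.zero_eta, Fin.mk_one, Fin.reduceFinMk] <;> linarith
  have hχ : ∀ q, √(ampSq (mps p b f a l q)) ≤ √C := fun q => by
    obtain ⟨α', β', γ', ξ', ω', hGl, hLl⟩ := hgram l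
    obtain ⟨b1, b2, b3, b4⟩ := hdiag hLl
    refine Real.sqrt_le_sqrt ?_
    have hs : ∀ {x : ℝ}, ampInner (mps p b f a l q) (mps p b f a l q) = x → |x| ≤ C →
        ampSq (mps p b f a l q) ≤ C := fun {x} h1 h2 => by
      rw [ampInner_self] at h1
      have h3 : ampSq (mps p b f a l q) = x := by exact_mod_cast h1
      rw [h3]; exact (le_abs_self x).trans h2
    fin_cases q
    · exact hs hGl.h00 b1
    · exact hs hGl.h11 b2
    · exact hs hGl.h22 b3
    · exact hs hGl.h33 b4
  rw [ampInner_eq_sum_sum (l := l) (m := m) (χ := mps p b f a l) (R := Rv) hφ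
    (append_eq_sum_restrictCoeff hpb hψ)]
  have hterm : ∀ j q, ‖ampInner (θ j) (mps p b f a l q) *
      ampInner (mps p b f a (m + 1) j) (Rv q)‖ ≤
      √(ampSq φ) / √κ * √C * ((ι * (6 * C + 1) + 12 * C) * η * M) := fun j q => by
    rw [norm_mul]
    refine mul_le_mul ((norm_ampInner_le _ _).trans ?_) (hRbound j q) (norm_nonneg _)
      (by positivity)
    exact mul_le_mul (hθ j) (hχ q) (Real.sqrt_nonneg _) (by positivity)
  calc _ ≤ ∑ j : Fin 4, ∑ q : Fin 4, √(ampSq φ) / √κ * √C *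
        ((ι * (6 * C + 1) + 12 * C) * η * M) :=
        norm_sum_le_of_le _ fun j _ => norm_sum_le_of_le _ fun q _ => hterm j q
    _ = _ := by
      simp only [Finset.sum_const, Finset.card_univ, Fintype.card_fin, hM, hη]
      simp only [nsmul_eq_mul]
      push_cast
      field_simp
      ring

/-! ### Norms of products of projections. -/

section projections
variable {E : Type*} [NormedAddCommGroup E] [InnerProductSpace ℂ E] [FiniteDimensional ℂ E]

/-- For W ≤ V the difference of the projections maps x to a vector ψ of V orthogonal to W with ‖ψ‖ ≤
‖x‖. Testing the hypothesis with φ the projection of ψ to U gives ‖φ‖² ≤ K‖φ‖‖ψ‖. -/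
lemma norm_starProjection_comp_sub_le {U V W : Submodule ℂ E} (hWV : W ≤ V) {K : ℝ} (hK : 0 ≤ K)
    (h : ∀ φ ∈ U, ∀ ψ ∈ V, ψ ∈ Wᗮ → ‖inner ℂ φ ψ‖ ≤ K * (‖φ‖ * ‖ψ‖)) :
    ‖U.starProjection ∘L (V.starProjection - W.starProjection)‖ ≤ K := by
  refine ContinuousLinearMap.opNorm_le_bound _ hK fun x => ?_
  set ψ : E := V.starProjection x - W.starProjection x with hψ
  have hψV : ψ ∈ V := V.sub_mem (V.starProjection_apply_mem x)
    (hWV (W.starProjection_apply_mem x))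
  have hψW : ψ ∈ Wᗮ := by
    rw [Submodule.mem_orthogonal]
    intro w hw
    rw [hψ, inner_sub_right, ← Submodule.inner_starProjection_left_eq_right,
      ← Submodule.inner_starProjection_left_eq_right,
      Submodule.starProjection_eq_self_iff.2 hw, Submodule.starProjection_eq_self_iff.2 (hWV hw),
      sub_self]
  have h1 : inner ℂ ψ ψ = inner ℂ ψ x := by
    have e1 : inner ℂ ψ (V.starProjection x) = inner ℂ ψ x := by
      rw [← Submodule.inner_starProjection_left_eq_right,
        Submodule.starProjection_eq_self_iff.2 hψV]
    have e2 : inner ℂ ψ (W.starProjection x) = 0 :=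
      Submodule.inner_left_of_mem_orthogonal (W.starProjection_apply_mem x) hψW
    conv_lhs => rw [hψ, inner_sub_right, ← hψ, e1, e2, sub_zero]
  have h2 : ‖ψ‖ ≤ ‖x‖ := by
    have h3 : ‖ψ‖ * ‖ψ‖ ≤ ‖ψ‖ * ‖x‖ := by
      have := norm_inner_le_norm (𝕜 := ℂ) ψ x
      rw [← h1, inner_self_eq_norm_sq_to_K] at this
      simpa [sq] using this
    rcases (norm_nonneg ψ).eq_or_lt with h0 | h0
    · rw [← h0]; exact norm_nonneg x
    · exact le_of_mul_le_mul_left h3 h0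
  change ‖U.starProjection ψ‖ ≤ K * ‖x‖
  set φ := U.starProjection ψ with hφ
  have hφU : φ ∈ U := U.starProjection_apply_mem ψ
  have h3 : inner ℂ φ ψ = inner ℂ φ φ := by
    conv_rhs => rw [hφ, ← Submodule.inner_starProjection_left_eq_right, ← hφ,
      Submodule.starProjection_eq_self_iff.2 hφU]
  have h4 : ‖φ‖ * ‖φ‖ ≤ ‖φ‖ * (K * ‖ψ‖) := by
    have := h φ hφU ψ hψV hψW
    rw [h3, inner_self_eq_norm_sq_to_K] at this
    calc ‖φ‖ * ‖φ‖ ≤ K * (‖φ‖ * ‖ψ‖) := by simpa [sq] using this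
      _ = _ := by ring
  have h5 : ‖φ‖ ≤ K * ‖ψ‖ := by
    rcases (norm_nonneg φ).eq_or_lt with h0 | h0
    · rw [← h0]; positivity
    · exact le_of_mul_le_mul_left h4 h0
  exact h5.trans (mul_le_mul_of_nonneg_left h2 hK)

end projections

/-! ### From kernels on the chain to the martingale norm. -/

lemma norm_eq_sqrt_ampSq {L : ℕ} (ψ : Chain L) : ‖ψ‖ = √(ampSq (fun σ => ψ σ)) :=
  EuclideanSpace.norm_eq ψ

lemma inner_eq_ampInner {L : ℕ} (φ ψ : Chain L) :
    inner ℂ φ ψ = ampInner (fun σ => φ σ) (fun σ => ψ σ) := by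
  rw [PiLp.inner_apply]
  simp [ampInner, mul_comm]

lemma ker_hamiltonian_mono (f : ℝ → ℝ) (g : ℝ → ℂ) (s : ℝ) (N a : ℕ) {b b' : ℕ} (h : b ≤ b') :
    LinearMap.ker (hamiltonian f g s N a b') ≤ LinearMap.ker (hamiltonian f g s N a b) := by
  intro ψ hψ
  rw [mem_ker_hamiltonian] at hψ ⊢
  exact fun x hx hxb => hψ x hx (hxb.trans_le h)

section kernels
variable {f : ℝ → ℝ} {g : ℝ → ℂ} {s : ℝ}

/-- The compatibility condition of `mps_mem_groundSpace` for p = cos s, b = sin s, a = -conj g; with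
this a, |a|² = |g|² = 1 - f² cos². -/
lemma mps_param (hcos : Real.cos s ≠ 0) :
    -(starRingEnd ℂ (g s)) * (Real.sin s : ℂ) +
      starRingEnd ℂ (g s) * (Real.sin s / Real.cos s ^ 2 : ℝ) * (Real.cos s : ℂ) ^ 2 = 0 := by
  have : (Real.cos s : ℂ) ≠ 0 := by exact_mod_cast hcos
  rw [Complex.ofReal_div, Complex.ofReal_pow]
  field_simp
  ring

lemma mps_mem_ker_hamiltonian (hcos : Real.cos s ≠ 0) (N : ℕ) (q : Fin 4) :
    (WithLp.toLp 2 (mps (Real.cos s) (Real.sin s) (f s) (-(starRingEnd ℂ (g s))) (N + 1) q) :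
      Chain (N + 1)) ∈ LinearMap.ker (hamiltonian f g s N 1 (N + 1)) := by
  rw [mem_ker_hamiltonian_iff_bondRel]
  intro x _ _ σ
  exact mps_mem_groundSpace (Real.cos_sq_add_sin_sq s) (mps_param hcos) N q x σ

lemma exists_coeff_of_mem_ker (hcos : Real.cos s ≠ 0) (hg : g s ≠ 0) {N : ℕ} (hN : 2 ≤ N)
    {ψ : Chain (N + 1)} (hψ : ψ ∈ LinearMap.ker (hamiltonian f g s N 1 N)) :
    ∃ c : Coeff, ∀ i, (fun τ => ψ (Fin.snoc τ i)) =
      c.slice (mps (Real.cos s) (Real.sin s) (f s) (-(starRingEnd ℂ (g s))) N) i := by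
  obtain ⟨n, rfl⟩ := Nat.exists_eq_add_of_le' hN
  rw [mem_ker_hamiltonian_iff_bondRel] at hψ
  have hi : ∀ i, (fun τ : Fin (n + 2) → Spin => ψ (Fin.snoc τ i)) ∈
      groundSpace (f s) (starRingEnd ℂ (g s) * (Real.sin s / Real.cos s ^ 2 : ℝ)) (n + 1) := by
    intro i x
    refine bondAt_castSucc (ψ := fun σ => ψ σ).1 (fun σ => hψ x.castSucc ?_ ?_ σ) i
    · simp
    · have := x.isLt
      simp only [Fin.val_castSucc]; omega
  choose c hc using fun i => exists_mps_coeff (Real.cos_sq_add_sin_sq s) (mps_param hcos) hcos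
    (neg_ne_zero.2 ((map_ne_zero _).2 hg)) (hi i)
  refine ⟨⟨fun i => c i 0, fun i => c i 1, fun i => c i 2, fun i => c i 3⟩, fun i => ?_⟩
  rw [hc i, Fin.sum_univ_four]
  rfl

lemma exists_right_coeff_of_mem_ker (hcos : Real.cos s ≠ 0) (hg : g s ≠ 0) {l m : ℕ} (hm : 1 ≤ m)
    {φ : Chain (l + m + 1)} (hφ : φ ∈ LinearMap.ker (hamiltonian f g s (l + m) (l + 1)
      (l + m + 1))) :
    ∃ θ : Fin 4 → (Fin l → Spin) → ℂ, ∀ (σ : Fin l → Spin) (τ : Fin (m + 1) → Spin),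
      φ (Fin.append (m := l) (n := m + 1) σ τ) = ∑ j, θ j σ *
        mps (Real.cos s) (Real.sin s) (f s) (-(starRingEnd ℂ (g s))) (m + 1) j τ := by
  obtain ⟨n, rfl⟩ := Nat.exists_eq_add_of_le' hm
  rw [mem_ker_hamiltonian_iff_bondRel] at hφ
  have hi : ∀ σ : Fin l → Spin, (fun τ : Fin (n + 1 + 1) → Spin =>
      φ (Fin.append (m := l) (n := n + 1 + 1) σ τ)) ∈
      groundSpace (f s) (starRingEnd ℂ (g s) * (Real.sin s / Real.cos s ^ 2 : ℝ)) (n + 1) := by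
    intro σ x
    refine bondAt_natAdd (ψ := fun σ => φ σ) (fun σ => hφ (Fin.natAdd l x) ?_ ?_ σ) σ
    · simp
    · exact Nat.succ_lt_succ (Fin.natAdd l x).isLt
  choose c hc using fun σ => exists_mps_coeff (Real.cos_sq_add_sin_sq s) (mps_param hcos) hcos
    (neg_ne_zero.2 ((map_ne_zero _).2 hg)) (hi σ)
  refine ⟨fun j σ => c σ j, fun σ τ => ?_⟩
  have := congrFun (hc σ) τ
  simpa only [Finset.sum_apply, Pi.smul_apply, smul_eq_mul] using this

lemma martingaleNorm_nonneg (k N : ℕ) : 0 ≤ martingaleNorm f g k N s := norm_nonneg _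

lemma martingaleNorm_le_one (k N : ℕ) : martingaleNorm f g k N s ≤ 1 :=
  norm_starProjection_comp_sub_le (ker_hamiltonian_mono f g s N 1 (Nat.le_succ N)) zero_le_one
    fun φ _ ψ _ _ => by rw [one_mul]; exact norm_inner_le_norm φ ψ

/-- Exponential decay of `martingaleNorm`, uniform in the parameters. -/
theorem exists_martingaleNorm_le {ε a₀ : ℝ} (hε : 0 < ε) (hε1 : ε < 1) (ha₀ : 0 < a₀) :
    ∃ K : ℝ, 0 ≤ K ∧ ∀ (f : ℝ → ℝ) (g : ℝ → ℂ) (s : ℝ), Real.cos s ≠ 0 →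
      a₀ ≤ 1 - f s ^ 2 * Real.cos s ^ 2 → ‖g s‖ ^ 2 + f s ^ 2 * Real.cos s ^ 2 = 1 →
      |f s| ≤ 1 → |t₂ f s| ≤ ε → |t₄ f s| ≤ ε →
      ∀ k N : ℕ, 1 ≤ k → k ≤ N → martingaleNorm f g k N s ≤ K * √ε ^ (k - 1) := by
  obtain ⟨K₀, K, hK₀, hK, hmain⟩ := exists_norm_ampInner_le hε hε1 ha₀
  refine ⟨max K (8 * K₀ / a₀), le_max_of_le_left hK, ?_⟩
  intro f g s hcos ha₀s hg hf ht2 ht4 k N hk hkN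
  obtain ⟨m, rfl⟩ := Nat.exists_eq_add_of_le' hk
  obtain ⟨l, rfl⟩ := Nat.exists_eq_add_of_le' (show m ≤ N by omega)
  have hl : 1 ≤ l := by omega
  rw [Nat.add_sub_cancel]
  have hr : 0 ≤ √ε ^ m := by positivity
  -- Blocks too short for the Gram estimate are covered by the trivial bound 1, which the second
  -- entry of the maximum absorbs.
  rcases le_or_gt (K₀ * √ε ^ m) (a₀ / 8) with hsmall | hbig
  · refine le_trans ?_ (mul_le_mul_of_nonneg_right (le_max_left _ _) hr)
    have ha1 : a₀ ≤ 1 := ha₀s.trans (by have := sq_nonneg (f s * Real.cos s); nlinarith)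
    -- Since K₀ ≥ 1 ≥ a₀, the smallness condition fails at m = 0. So the right block has at least
    -- two sites, as the basis expansion requires.
    have hm : 1 ≤ m := by
      by_contra h
      have : m = 0 := by omega
      rw [this, pow_zero, mul_one] at hsmall
      linarith
    have hgs : g s ≠ 0 := by
      intro h
      rw [h, norm_zero] at hg
      linarith
    have ea : starRingEnd ℂ (-(starRingEnd ℂ (g s))) * -(starRingEnd ℂ (g s)) =
        ((1 - f s ^ 2 * Real.cos s ^ 2 : ℝ) : ℂ) := by
      rw [map_neg, Complex.conj_conj, neg_mul_neg, Complex.mul_conj']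
      have : ‖g s‖ ^ 2 = 1 - f s ^ 2 * Real.cos s ^ 2 := by linarith
      exact_mod_cast this
    have hmain' := hmain (Real.cos s) (Real.sin s) (f s) _ (-(starRingEnd ℂ (g s)))
      (Real.cos_sq_add_sin_sq s) rfl ea ha₀s hf ht2 ht4 l m hsmall
    have hidx : l + m - (m + 1) + 2 = l + 1 := by omega
    rw [martingaleNorm, groundProj, groundProj, groundProj, hidx]
    refine norm_starProjection_comp_sub_le
      (ker_hamiltonian_mono f g s (l + m) 1 (Nat.le_succ (l + m))) (by positivity) ?_
    intro φ hφ ψ hψ hperp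
    obtain ⟨θ, hθ⟩ := exists_right_coeff_of_mem_ker hcos hgs hm hφ
    obtain ⟨c, hc⟩ := exists_coeff_of_mem_ker hcos hgs (by omega) hψ
    rw [inner_eq_ampInner, norm_eq_sqrt_ampSq, norm_eq_sqrt_ampSq]
    refine hmain' (fun σ => φ σ) (fun σ => ψ σ) θ c hθ hc fun j => ?_
    have := (Submodule.mem_orthogonal _ _).1 hperp _ (mps_mem_ker_hamiltonian (f := f) (g := g)
      hcos (l + m) j)
    rwa [inner_eq_ampInner] at this
  · refine (martingaleNorm_le_one _ _).trans ?_
    refine le_trans ?_ (mul_le_mul_of_nonneg_right (le_max_right _ _) hr)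
    rw [div_mul_eq_mul_div, le_div_iff₀ ha₀]
    linarith

end kernels

/-! ### Uniform bounds along the path. -/

lemma s₀_pos : 0 < s₀ := Real.arcsin_pos.2 (Real.sqrt_pos.2 (by norm_num))

lemma s₀_lt_pi_div_two : s₀ < Real.pi / 2 := by
  rw [s₀, Real.arcsin_lt_pi_div_two, Real.sqrt_lt' one_pos]
  norm_num

lemma cos_pos_of_mem_Icc {s : ℝ} (hs : s ∈ Icc 0 s₀) : 0 < Real.cos s :=
  Real.cos_pos_of_mem_Ioo ⟨by linarith [hs.1, Real.pi_pos], hs.2.trans_lt s₀_lt_pi_div_two⟩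

section decay
variable {f : ℝ → ℝ}

/-- Strictness comes from f(0) < 1 at s = 0, and from cos² s < 1 together with f ≤ 1 elsewhere. -/
lemma mul_cos_sq_lt_one (hmono : MonotoneOn f (Icc 0 s₀)) (hf0 : 0 < f 0) (hf0' : f 0 < 1)
    (hfs : f s₀ = 1) {s : ℝ} (hs : s ∈ Icc 0 s₀) :
    0 < f s ∧ f s ≤ 1 ∧ f s * Real.cos s ^ 2 < 1 ∧ f s ^ 2 * Real.cos s ^ 2 < 1 := by
  have h0 : 0 < f s := hf0.trans_le (hmono ⟨le_rfl, s₀_pos.le⟩ hs hs.1)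
  have h1 : f s ≤ 1 := hfs ▸ hmono hs ⟨s₀_pos.le, le_rfl⟩ hs.2
  have hc := cos_pos_of_mem_Icc hs
  have key : f s * Real.cos s ^ 2 < 1 := by
    rcases hs.1.eq_or_lt with h | h
    · rw [← h]; simpa using hf0'
    · have hs' : 0 < Real.sin s :=
        Real.sin_pos_of_pos_of_lt_pi h (by linarith [hs.2, s₀_lt_pi_div_two, Real.pi_pos])
      have hc2 : Real.cos s ^ 2 < 1 := by nlinarith [Real.cos_sq_add_sin_sq s]
      calc f s * Real.cos s ^ 2 ≤ 1 * Real.cos s ^ 2 := by gcongr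
        _ < 1 := by linarith
  refine ⟨h0, h1, key, lt_of_le_of_lt ?_ key⟩
  have : f s ^ 2 ≤ f s := by nlinarith
  gcongr

/-- For t₄: it is at most f² cos² < 1 and at least -sin² > -1, as cos s > 0 on the path. -/
lemma abs_t₂_t₄_lt_one (hmono : MonotoneOn f (Icc 0 s₀)) (hf0 : 0 < f 0) (hf0' : f 0 < 1)
    (hfs : f s₀ = 1) {s : ℝ} (hs : s ∈ Icc 0 s₀) : max |t₂ f s| |t₄ f s| < 1 := by
  obtain ⟨h0, h1, h2, h3⟩ := mul_cos_sq_lt_one hmono hf0 hf0' hfs hs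
  have hc := cos_pos_of_mem_Icc hs
  have hcs := Real.cos_sq_add_sin_sq s
  have hc2 : 0 < Real.cos s ^ 2 := by positivity
  have hf2 : 0 ≤ f s ^ 2 * Real.cos s ^ 2 := by positivity
  refine max_lt ?_ ?_
  · rw [t₂, neg_mul, abs_neg, abs_of_nonneg (by positivity)]
    exact h2
  · rw [t₄, abs_lt]
    constructor <;> nlinarith [sq_nonneg (Real.sin s)]

/-- Bounds that are uniform along the path, by compactness. -/
lemma decayRate_bounds (hf : ContinuousOn f (Icc 0 s₀)) (hmono : MonotoneOn f (Icc 0 s₀))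
    (hf0 : 0 < f 0) (hf0' : f 0 < 1) (hfs : f s₀ = 1) :
    0 < decayRate f ∧ decayRate f < 1 ∧
      (∀ s ∈ Icc 0 s₀, |t₂ f s| ≤ decayRate f ∧ |t₄ f s| ≤ decayRate f) ∧
      ∃ a₀ > 0, ∀ s ∈ Icc 0 s₀, a₀ ≤ 1 - f s ^ 2 * Real.cos s ^ 2 := by
  have hne : (Icc 0 s₀).Nonempty := ⟨0, le_rfl, s₀_pos.le⟩
  have hcos : ContinuousOn (fun s => Real.cos s ^ 2) (Icc 0 s₀) := by fun_prop
  have hsin : ContinuousOn (fun s => Real.sin s ^ 2) (Icc 0 s₀) := by fun_prop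
  have h2 : ContinuousOn (t₂ f) (Icc 0 s₀) := hf.neg.mul hcos
  have h4 : ContinuousOn (t₄ f) (Icc 0 s₀) := ((hf.pow 2).mul hcos).sub hsin
  have hmax : ContinuousOn (fun s => max |t₂ f s| |t₄ f s|) (Icc 0 s₀) := h2.abs.sup h4.abs
  obtain ⟨x, hx, hxm⟩ := isCompact_Icc.exists_isMaxOn hne hmax
  have hbdd : BddAbove ((fun s => max |t₂ f s| |t₄ f s|) '' Icc 0 s₀) :=
    (isCompact_Icc.image_of_continuousOn hmax).bddAbove
  have hle : ∀ s ∈ Icc 0 s₀, max |t₂ f s| |t₄ f s| ≤ decayRate f := fun s hs =>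
    le_csSup hbdd ⟨s, hs, rfl⟩
  refine ⟨?_, ?_, fun s hs => ⟨(le_max_left _ _).trans (hle s hs),
    (le_max_right _ _).trans (hle s hs)⟩, ?_⟩
  -- Positivity of ε, needed to divide by it, is read off at s = 0, where |t₂| = f(0).
  · have h0 := (le_max_left _ _).trans (hle 0 ⟨le_rfl, s₀_pos.le⟩)
    have e : |t₂ f 0| = f 0 := by simp [t₂, abs_of_pos hf0]
    linarith
  · refine lt_of_le_of_lt (csSup_le (hne.image _) ?_) (abs_t₂_t₄_lt_one hmono hf0 hf0' hfs hx)
    rintro _ ⟨s, hs, rfl⟩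
    exact hxm hs
  · have hA : ContinuousOn (fun s => 1 - f s ^ 2 * Real.cos s ^ 2) (Icc 0 s₀) :=
      continuousOn_const.sub ((hf.pow 2).mul hcos)
    obtain ⟨y, hy, hym⟩ := isCompact_Icc.exists_isMinOn hne hA
    have := (mul_cos_sq_lt_one hmono hf0 hf0' hfs hy).2.2.2
    exact ⟨_, by linarith, fun s hs => hym hs⟩

end decay

lemma eventually_mul_pow_lt_inv {ε K : ℝ} (hε : 0 < ε) (hε1 : ε < 1) (hK : 0 ≤ K) :
    ∃ k₁ : ℕ, ∀ k : ℕ, 1 ≤ k → k₁ ≤ k → K * ε ^ (k - 1) < 1 / (k : ℝ) := by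
  have h := tendsto_self_mul_const_pow_of_lt_one hε.le hε1
  -- The threshold ε/(K + 1) supplies the missing power of ε, since the exponent is k - 1, and K + 1
  -- avoids dividing by zero.
  have hev := h.eventually (gt_mem_nhds (show 0 < ε / (K + 1) by positivity))
  obtain ⟨k₁, hk₁⟩ := Filter.eventually_atTop.1 hev
  refine ⟨k₁, fun k hk hkk => ?_⟩
  have h1 := hk₁ k hkk
  have hk0 : (0 : ℝ) < k := by exact_mod_cast hk
  obtain ⟨n, rfl⟩ := Nat.exists_eq_add_of_le' hk
  rw [Nat.add_sub_cancel, lt_div_iff₀ hk0]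
  rw [lt_div_iff₀ (by positivity)] at h1
  have h2 : ((n + 1 : ℕ) : ℝ) * ε ^ n * (K + 1) < 1 := by
    have : ((n + 1 : ℕ) : ℝ) * ε ^ (n + 1) * (K + 1) =
        (((n + 1 : ℕ) : ℝ) * ε ^ n * (K + 1)) * ε := by ring
    rw [this] at h1
    exact (mul_lt_iff_lt_one_left hε).1 h1
  have h3 : 0 < ((n + 1 : ℕ) : ℝ) * ε ^ n := by positivity
  linarith

end AKLTPath

theorem lemma3p7 (f : ℝ → ℝ) (g : ℝ → ℂ)
    (hf : ContDiffOn ℝ 1 f (Icc 0 AKLTPath.s₀))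
    (hmono : MonotoneOn f (Icc 0 AKLTPath.s₀))
    (hf0 : 0 < f 0) (hf0' : f 0 < 1) (hfs : f AKLTPath.s₀ = 1)
    (hg : ∀ s ∈ Icc 0 AKLTPath.s₀, ‖g s‖ ^ 2 + f s ^ 2 * Real.cos s ^ 2 = 1) :
    (AKLTPath.decayRate f < 1 ∧
      ∃ C : ℝ → ℝ, ContinuousOn C (Ioc 0 AKLTPath.s₀) ∧
        ∀ s ∈ Icc 0 AKLTPath.s₀, ∀ k N : ℕ, 1 ≤ k → k ≤ N → 2 * k - 2 ≤ N →
          AKLTPath.martingaleNorm f g k N s ^ 2 ≤ C s * AKLTPath.decayRate f ^ (k - 1)) ∧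
    (∀ c s₁ s₂ δ : ℝ, 0 < c → c < 1 →
      s₁ ∈ Icc 0 (Real.pi / 2) → Real.sin s₁ ^ 2 = (1 - c ^ 2) / (1 + c ^ 2) →
      s₂ ∈ Icc 0 (Real.pi / 2) →
      Real.sin s₂ ^ 2 = c ^ 2 * (1 - 2 * Real.log c) / (1 + c ^ 2) →
      δ = min (min s₁ s₂) (AKLTPath.s₀ / 2) →
      (∀ s, 0 ≤ s → s < δ → f s = c) →
        ∃ k₁ : ℕ, ∀ k N : ℕ, 1 ≤ k → k₁ ≤ k → k ≤ N → 2 * k - 2 ≤ N →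
          ∀ s, 0 ≤ s → s < δ → AKLTPath.martingaleNorm f g k N s ^ 2 < 1 / (k : ℝ)) := by
  obtain ⟨hε, hε1, ht, a₀, ha₀, hA⟩ :=
    AKLTPath.decayRate_bounds hf.continuousOn hmono hf0 hf0' hfs
  obtain ⟨K, hK, hmain⟩ := AKLTPath.exists_martingaleNorm_le hε hε1 ha₀
  have hbound : ∀ s ∈ Icc 0 AKLTPath.s₀, ∀ k N : ℕ, 1 ≤ k → k ≤ N →
      AKLTPath.martingaleNorm f g k N s ^ 2 ≤ K ^ 2 * AKLTPath.decayRate f ^ (k - 1) := by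
    intro s hs k N hk hkN
    obtain ⟨h0, h1, -, -⟩ := AKLTPath.mul_cos_sq_lt_one hmono hf0 hf0' hfs hs
    have h := hmain f g s (AKLTPath.cos_pos_of_mem_Icc hs).ne' (hA s hs) (hg s hs)
      (abs_le.2 ⟨by linarith, h1⟩) (ht s hs).1 (ht s hs).2 k N hk hkN
    calc AKLTPath.martingaleNorm f g k N s ^ 2
        ≤ (K * √(AKLTPath.decayRate f) ^ (k - 1)) ^ 2 :=
          pow_le_pow_left₀ (AKLTPath.martingaleNorm_nonneg k N) h 2
      _ = K ^ 2 * (√(AKLTPath.decayRate f) ^ 2) ^ (k - 1) := by rw [mul_pow, pow_right_comm]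
      _ = K ^ 2 * AKLTPath.decayRate f ^ (k - 1) := by rw [Real.sq_sqrt hε.le]
  -- K is uniform along the path, so the constant function K² serves as C, also at s = 0.
  refine ⟨⟨hε1, fun _ => K ^ 2, continuousOn_const, fun s hs k N hk hkN _ =>
    hbound s hs k N hk hkN⟩, ?_⟩
  intro c s₁ s₂ δ _ _ _ _ _ _ hδ _
  obtain ⟨k₁, hk₁⟩ := AKLTPath.eventually_mul_pow_lt_inv hε hε1 (sq_nonneg K)
  refine ⟨k₁, fun k N hk hkk hkN _ s hs hsδ => (hbound s ⟨hs, ?_⟩ k N hk hkN).trans_lt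
    (hk₁ k hk hkk)⟩
  have h1 : δ ≤ AKLTPath.s₀ / 2 := hδ ▸ min_le_right _ _
  linarith [AKLTPath.s₀_pos]
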